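/- **Conventions.** A diffeology on a set is given by its plots; subspaces, products and fibre products carry the usual diffeologies, and $C^\infty(A,B)$ the functional diffeology. Let $\pi_{set}(t)=\max\{0,\min\{1,t\}\}$ on $\mathbb{R}$. For a diffeological space $X$ let $\mathrm{Path}(X)=\{u\in C^\infty(\mathbb{R},X) : u\circ\pi_{set}=u\}$, a subspace of $C^\infty(\mathbb{R},X)$. **Internal precategories.** An internal precategory $(G,X)$ consists of diffeological spaces $G,X$ and smooth maps $\sigma,\tau:G\to X$, $\iota:X\to G$ with $\sigma\iota=\tau\iota=1_X$. Put $G^n=\{(g_1,\dots,g_n) : \tau(g_i)=\sigma(g_{i+1}),\ 1\le i<n\}$. The pair $(\mathrm{Path}(X),X)$ is an internal precategory with $\sigma(u)=u(0)$, $\tau(u)=u(1)$ and $\iota(x)$ the constant path at $x$. **Associahedra.** Let $\mathbb{b}_n=(0,\frac12,\dots,\frac12,\frac n2)\in\mathbb{R}^n$ for $n\ge 2$. For $r+s=n+1$ and $1\le k\le r$ let $$\partial_k:\mathbb{R}^r\times\mathbb{R}^s\to\mathbb{R}^n,\quad \partial_k(t,u)=(t_1,\dots,t_{k-1},u_1,\dots,u_{s-1},u_s+t_k,t_{k+1},\dots,t_r).$$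 The cubic complexes $\mathbb{K}(n)$, $n\ge2$, are defined inductively. The nonempty cells of $\mathbb{K}(n)$ are the point $\mathbb{b}_n$, the cells $\partial_k(\sigma_1\times\sigma_2)$, and the joins $\partial_k(\sigma_1\times\sigma_2)*\mathbb{b}_n$, where $\sigma_1\in\mathbb{K}(r)$ and $\sigma_2\in\mathbb{K}(s)$ are nonempty cells, $r,s\ge2$, $r+s=n+1$, $1\le k\le r$. Each $q$-dimensional cell $\sigma$ has a parametrisation $\pi_\sigma:\mathbb{R}^q\to\sigma$: a point has the constant one; a product cell has $\partial_k\circ(\pi_{\sigma_1}\times\pi_{\sigma_2})$; and a join $\sigma*\mathbb{b}_n$ has $(x,t)\mapsto(1-\pi_{set}(t))\,\pi_\sigma(x)+\pi_{set}(t)\,\mathbb{b}_n$. The polyhedron $|\mathbb{K}(n)|\subset\mathbb{R}^n$ is the union of the cells. It carries the colimit diffeology, that is, the finest diffeology for which all maps $\pi_\sigma:\mathbb{R}^q\to|\mathbb{K}(n)|$ are smooth. **h-unital $A_\infty$-categories.** An internal precategory $(G,X)$ is an *internal h-unital smooth $A_\infty$-category* if there are smooth maps $M(n):|\mathbb{K}(n)|\times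 G^n\to G$, $n\ge2$, such that - (0) $\sigma(M(n)(\rho;g_1,\dots,g_n))=\sigma(g_1)$ and $\tau(M(n)(\rho;g_1,\dots,g_n))=\tau(g_n)$; - (1) $M(n)(\partial_k(\rho,\rho');g_1,\dots,g_n)=M(r)(\rho;g_1,\dots,g_{k-1},M(s)(\rho';g_k,\dots,g_{k+s-1}),g_{k+s},\dots,g_n)$ for all $r,s\ge 2$ with $r+s=n+1$, $1\le k\le r$, $\rho\in|\mathbb{K}(r)|$, $\rho'\in|\mathbb{K}(s)|$ and $(g_1,\dots,g_n)\in G^n$; - (2') the maps $G\to G$, $g\mapsto M(2)(\mathbb{b}_2;\iota\sigma(g),g)$ and $g\mapsto M(2)(\mathbb{b}_2;g,\iota\tau(g))$, are each smoothly homotopic to the identity through maps preserving $\sigma$ and $\tau$. Here a smooth homotopy is a smooth map $H:G\times\mathbb{R}\to G$ with $H(g,\pi_{set}(t))=H(g,t)$, running from $H(\cdot,0)$ to $H(\cdot,1)$. **Theorem.** For every diffeological space $X$ (no reflexivity is assumed), $(\mathrm{Path}(X),X)$ is an internal h-unital smooth $A_\infty$-category. -/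

import Mathlib

open scoped ContDiff

namespace SmoothAInfty

open Diffeology

/-! ### Standard constructions on diffeological spaces -/

/-- The pullback diffeology along `f`: a map `p` is a plot iff `f ∘ p` is a plot. -/
@[reducible]
def inducedDiffeology {X Y : Type*} [DiffeologicalSpace Y] (f : X → Y) :
    DiffeologicalSpace X where
  plots n := {p | IsPlot (f ∘ p)}
  constant_plots x := isPlot_const (x := f x)
  plot_reparam hp hf := isPlot_reparam (X := Y) hp hf
  locality hp := DiffeologicalSpace.locality (X := Y) fun x ↦ by
    obtain ⟨u, hu, hx, h⟩ := hp x
    exact ⟨u, hu, hx, fun hfu hf ↦ h hfu hf⟩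

/-- The subspace diffeology. -/
instance instSubtype {X : Type*} [DiffeologicalSpace X] (P : X → Prop) :
    DiffeologicalSpace {x // P x} :=
  inducedDiffeology Subtype.val

/-- The product diffeology on an indexed product. -/
instance instPi {ι : Type*} {X : ι → Type*} [∀ i, DiffeologicalSpace (X i)] :
    DiffeologicalSpace (∀ i, X i) where
  plots n := {p | ∀ i, IsPlot fun a ↦ p a i}
  constant_plots x i := isPlot_const (x := x i)
  plot_reparam hp hf i := isPlot_reparam (hp i) hf
  locality hp i := DiffeologicalSpace.locality (X := X i) fun x ↦ by
    obtain ⟨u, hu, hx, h⟩ := hp x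
    exact ⟨u, hu, hx, fun hfu hf ↦ h hfu hf i⟩

/-- The product diffeology on a binary product. -/
instance instProd {X Y : Type*} [DiffeologicalSpace X] [DiffeologicalSpace Y] :
    DiffeologicalSpace (X × Y) where
  plots n := {p | (IsPlot fun a ↦ (p a).1) ∧ IsPlot fun a ↦ (p a).2}
  constant_plots x := ⟨isPlot_const (x := x.1), isPlot_const (x := x.2)⟩
  plot_reparam hp hf := ⟨isPlot_reparam hp.1 hf, isPlot_reparam hp.2 hf⟩
  locality hp :=
    ⟨DiffeologicalSpace.locality (X := X) fun x ↦ by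
      obtain ⟨u, hu, hx, h⟩ := hp x
      exact ⟨u, hu, hx, fun hfu hf ↦ (h hfu hf).1⟩,
     DiffeologicalSpace.locality (X := Y) fun x ↦ by
      obtain ⟨u, hu, hx, h⟩ := hp x
      exact ⟨u, hu, hx, fun hfu hf ↦ (h hfu hf).2⟩⟩

/-- The set `C^∞(X, Y)` of smooth maps. -/
@[ext]
structure SmoothMap (X Y : Type*) [DiffeologicalSpace X] [DiffeologicalSpace Y] where
  /-- The underlying map. -/
  toFun : X → Y
  /-- The underlying map is smooth. -/
  smooth : DSmooth toFun

/-- The functional diffeology on `C^∞(X, Y)`: `p` is a plot iff its adjoint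
`(a, x) ↦ p a x` is smooth. -/
instance instSmoothMap {X Y : Type*} [DiffeologicalSpace X] [DiffeologicalSpace Y] :
    DiffeologicalSpace (SmoothMap X Y) where
  plots n := {p | DSmooth fun z : EuclideanSpace ℝ (Fin n) × X ↦ (p z.1).toFun z.2}
  constant_plots f _ _ hq := f.smooth _ _ hq.2
  plot_reparam {n m p f} hp hf l q hq := by
    have hq' : IsPlot (fun a ↦ (f (q a).1, (q a).2)) :=
      ⟨(hf.comp (isPlot_iff_contDiff.1 hq.1)).isPlot, hq.2⟩
    exact hp l _ hq'
  locality {n p} hp m q hq := by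
    refine DiffeologicalSpace.locality (X := Y) fun x ↦ ?_
    obtain ⟨u, hu, hx, h⟩ := hp (q x).1
    have hc : ContDiff ℝ ∞ fun a ↦ (q a).1 := isPlot_iff_contDiff.1 hq.1
    refine ⟨(fun a ↦ (q a).1) ⁻¹' u, hu.preimage hc.continuous, hx, fun {l f} hfu hf ↦ ?_⟩
    have h2 : IsPlot (fun a ↦ (q (f a)).2) := isPlot_reparam hq.2 hf
    have h3 : IsPlot (fun a : EuclideanSpace ℝ (Fin l) ↦ (a, (q (f a)).2)) := ⟨isPlot_id, h2⟩
    exact h (f := fun a ↦ (q (f a)).1) hfu (hc.comp hf) l _ h3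

/-! ### Path spaces -/

/-- The retraction `π_set : ℝ → [0, 1] ⊆ ℝ`, `t ↦ max 0 (min 1 t)`. -/
def clamp (t : ℝ) : ℝ := max 0 (min 1 t)

/-- `Path(X)`: the smooth maps `u : ℝ → X` with `u ∘ π_set = u`, with the subspace diffeology
of `C^∞(ℝ, X)`. -/
abbrev PathSpace (X : Type*) [DiffeologicalSpace X] :=
  {u : SmoothMap ℝ X // ∀ t, u.toFun (clamp t) = u.toFun t}

/-! ### Internal precategories -/

/-- An internal precategory `(G, X)` in diffeological spaces: smooth source and target maps
`G → X` with a common smooth section. -/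
structure InternalPrecategory (G X : Type*) [DiffeologicalSpace G] [DiffeologicalSpace X] where
  /-- The source map. -/
  src : G → X
  /-- The target map. -/
  tgt : G → X
  /-- The unit map. -/
  unit : X → G
  smooth_src : DSmooth src
  smooth_tgt : DSmooth tgt
  smooth_unit : DSmooth unit
  src_unit : ∀ x, src (unit x) = x
  tgt_unit : ∀ x, tgt (unit x) = x

lemma dSmooth_eval {X : Type*} [DiffeologicalSpace X] (t : ℝ) :
    DSmooth fun u : PathSpace X ↦ u.1.toFun t := by
  intro n p hp
  have h : IsPlot (fun a : EuclideanSpace ℝ (Fin n) ↦ (a, t)) := ⟨isPlot_id, isPlot_const⟩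
  exact (show DSmooth fun z : EuclideanSpace ℝ (Fin n) × ℝ ↦ ((p z.1).1).toFun z.2 from hp) n _ h

/-- The internal precategory `(Path(X), X)`: source `u ↦ u 0`, target `u ↦ u 1`, and the unit
sends a point to the constant path. -/
def pathPrecategory (X : Type*) [DiffeologicalSpace X] : InternalPrecategory (PathSpace X) X where
  src u := u.1.toFun 0
  tgt u := u.1.toFun 1
  unit x := ⟨⟨fun _ ↦ x, dSmooth_const⟩, fun _ ↦ rfl⟩
  smooth_src := dSmooth_eval 0
  smooth_tgt := dSmooth_eval 1
  smooth_unit := fun _ _ hp _ _ hq ↦ isPlot_reparam hp (isPlot_iff_contDiff.1 hq.1)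
  src_unit _ := rfl
  tgt_unit _ := rfl

section Chains

variable {G X : Type*} [DiffeologicalSpace G] [DiffeologicalSpace X]

/-- `G^n = G ×_X ⋯ ×_X G`: the `n`-tuples `(g_1, …, g_n)` with `tgt g_i = src g_{i+1}`, as a
subspace of the product. -/
abbrev Chain (C : InternalPrecategory G X) (n : ℕ) :=
  {g : Fin n → G // ∀ (i : ℕ) (hi : i + 1 < n), C.tgt (g ⟨i, by omega⟩) = C.src (g ⟨i + 1, hi⟩)}

variable {C : InternalPrecategory G X}

/-- The pair `(a, b)` as an element of `G ×_X G`. -/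
def Chain.pair (a b : G) (h : C.tgt a = C.src b) : Chain C 2 :=
  ⟨![a, b], fun i hi ↦ by
    obtain rfl : i = 0 := by omega
    exact h⟩

/-- The subtuple `(g_k, …, g_{k+s-1})`; here `k` is counted from `0`. -/
def Chain.sub {n r s : ℕ} (hn : r + s = n + 1) (k : Fin r) (g : Chain C n) : Chain C s :=
  ⟨fun j ↦ g.1 ⟨k + j, by omega⟩, fun i hi ↦ g.2 (k + i) (by omega)⟩

/-- The tuple `(g_1, …, g_{k-1}, m, g_{k+s}, …, g_n)`, obtained by replacing
`(g_k, …, g_{k+s-1})` by one element `m` with the appropriate source and target; here `k` is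
counted from `0`. -/
def Chain.graft {n r s : ℕ} (hn : r + s = n + 1) (hs : 2 ≤ s) (k : Fin r) (g : Chain C n) (m : G)
    (hsrc : C.src m = C.src ((g.sub hn k).1 ⟨0, by omega⟩))
    (htgt : C.tgt m = C.tgt ((g.sub hn k).1 ⟨s - 1, by omega⟩)) : Chain C r :=
  ⟨fun i ↦ if i.1 < k.1 then g.1 ⟨i, by omega⟩
    else if i.1 = k.1 then m
    else g.1 ⟨i + s - 1, by omega⟩, fun i hi ↦ by
    have hk := k.2
    simp only [Chain.sub] at hsrc htgt
    rcases lt_trichotomy (i + 1) k.1 with h | h | h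
    · simp only [if_pos h, if_pos (show i < k.1 by omega)]
      exact g.2 i (by omega)
    · simp only [if_pos (show i < k.1 by omega), if_neg (show ¬ i + 1 < k.1 by omega), if_pos h]
      rw [hsrc, g.2 i (by omega)]
      exact congrArg (fun j ↦ C.src (g.1 j)) (Fin.ext (by simp only []; omega))
    · rcases Nat.lt_or_ge k.1 i with h' | h'
      · simp only [if_neg (show ¬ i < k.1 by omega), if_neg (show ¬ i = k.1 by omega),
          if_neg (show ¬ i + 1 < k.1 by omega), if_neg (show ¬ i + 1 = k.1 by omega)]
        rw [g.2 (i + s - 1) (by omega)]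
        exact congrArg (fun j ↦ C.src (g.1 j)) (Fin.ext (by simp only []; omega))
      · obtain rfl : i = k.1 := by omega
        simp only [lt_irrefl, if_false, if_true, if_neg (show ¬ k.1 + 1 < k.1 by omega),
          if_neg (show ¬ k.1 + 1 = k.1 by omega)]
        rw [htgt, g.2 (k.1 + (s - 1)) (by omega)]
        exact congrArg (fun j ↦ C.src (g.1 j)) (Fin.ext (by simp only []; omega))⟩

end Chains

/-! ### Associahedra as smooth cubic complexes -/

/-- The interior point `b_n = (0, 1/2, …, 1/2, n/2)` of the associahedron `K_n ⊆ ℝ^n`. -/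
noncomputable def bary (n : ℕ) : Fin n → ℝ := fun i ↦
  if i.1 = 0 then 0 else if i.1 + 1 = n then (n : ℝ) / 2 else 1 / 2

/-- The face operator `∂_k : ℝ^r × ℝ^s → ℝ^n`, `r + s = n + 1`,
`((t_i), (u_j)) ↦ (t_1, …, t_{k-1}, u_1, …, u_{s-1}, u_s + t_k, t_{k+1}, …, t_r)`;
here `k` and all coordinates are counted from `0`. -/
def faceMap {n r s : ℕ} (hn : r + s = n + 1) (k : Fin r) (t : Fin r → ℝ) (u : Fin s → ℝ) :
    Fin n → ℝ := fun i ↦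
  if h₁ : i.1 < k.1 then t ⟨i, by omega⟩
  else if h₂ : i.1 < k.1 + s then
    u ⟨i - k, by omega⟩ + (if i.1 + 1 = k.1 + s then t k else 0)
  else t ⟨i + 1 - s, by omega⟩

/-- The product `∂_k(σ₁ × σ₂)` of two parametrised cells `π₁ : ℝ^{q₁} → σ₁ ⊆ ℝ^r` and
`π₂ : ℝ^{q₂} → σ₂ ⊆ ℝ^s`, parametrised by `ℝ^{q₁ + q₂}`. -/
def faceChart {n r s q₁ q₂ : ℕ} (hn : r + s = n + 1) (k : Fin r)
    (π₁ : EuclideanSpace ℝ (Fin q₁) → (Fin r → ℝ))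
    (π₂ : EuclideanSpace ℝ (Fin q₂) → (Fin s → ℝ)) :
    EuclideanSpace ℝ (Fin (q₁ + q₂)) → (Fin n → ℝ) := fun x ↦
  faceMap hn k (π₁ (WithLp.toLp 2 fun i ↦ x (Fin.castAdd q₂ i)))
    (π₂ (WithLp.toLp 2 fun j ↦ x (Fin.natAdd q₁ j)))

/-- The join `σ * b_n` of a parametrised cell `π : ℝ^q → σ ⊆ ℝ^n` with the point `b_n`,
parametrised by `ℝ^q × ℝ`, `(x, t) ↦ (1 - π_set t) π(x) + (π_set t) b_n`. -/
noncomputable def coneChart {n q : ℕ} (π : EuclideanSpace ℝ (Fin q) → (Fin n → ℝ)) :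
    EuclideanSpace ℝ (Fin (q + 1)) → (Fin n → ℝ) := fun x ↦
  (1 - clamp (x (Fin.last q))) • π (WithLp.toLp 2 fun i ↦ x i.castSucc) +
    clamp (x (Fin.last q)) • bary n

/-- The nonempty cells of the cubic complexes `𝕂(n)`, `n ≥ 2`, each presented by the map
`π_σ : ℝ^q → σ ⊆ ℝ^n` whose image it is and which defines its diffeology. They are built
inductively: `𝕂(n)` consists of the point `b_n`, of the cells `∂_k(σ₁ × σ₂)` with `σ₁ ∈ 𝕂(r)`,
`σ₂ ∈ 𝕂(s)`, `r + s = n + 1`, `r, s ≥ 2`, and of their joins with `b_n`. -/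
inductive IsCell : (n q : ℕ) → (EuclideanSpace ℝ (Fin q) → (Fin n → ℝ)) → Prop
  | apex {n : ℕ} (hn : 2 ≤ n) : IsCell n 0 fun _ ↦ bary n
  | face {n r s q₁ q₂ : ℕ} (hn : r + s = n + 1) (hr : 2 ≤ r) (hs : 2 ≤ s) (k : Fin r)
      {π₁ : EuclideanSpace ℝ (Fin q₁) → (Fin r → ℝ)}
      {π₂ : EuclideanSpace ℝ (Fin q₂) → (Fin s → ℝ)}
      (h₁ : IsCell r q₁ π₁) (h₂ : IsCell s q₂ π₂) :
      IsCell n (q₁ + q₂) (faceChart hn k π₁ π₂)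
  | cone {n r s q₁ q₂ : ℕ} (hn : r + s = n + 1) (hr : 2 ≤ r) (hs : 2 ≤ s) (k : Fin r)
      {π₁ : EuclideanSpace ℝ (Fin q₁) → (Fin r → ℝ)}
      {π₂ : EuclideanSpace ℝ (Fin q₂) → (Fin s → ℝ)}
      (h₁ : IsCell r q₁ π₁) (h₂ : IsCell s q₂ π₂) :
      IsCell n (q₁ + q₂ + 1) (coneChart (faceChart hn k π₁ π₂))

/-- The polyhedron `|𝕂(n)| ⊆ ℝ^n`, the union of all cells of `𝕂(n)`. -/
@[ext]
structure Associahedron (n : ℕ) where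
  /-- The underlying point of `ℝ^n`. -/
  val : Fin n → ℝ
  mem_cell : ∃ (q : ℕ) (π : EuclideanSpace ℝ (Fin q) → (Fin n → ℝ)),
    IsCell n q π ∧ val ∈ Set.range π

/-- The diffeology on `|𝕂(n)| = colim σ`, where each cell `σ` has the quotient diffeology of
`π_σ : ℝ^q → σ`: it is the finest diffeology for which all the maps `π_σ : ℝ^q → |𝕂(n)|` are
smooth. -/
instance instAssociahedron (n : ℕ) : DiffeologicalSpace (Associahedron n) :=
  DiffeologicalSpace.generateFrom {p | IsCell n p.1 fun x ↦ (p.2 x).val}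

/-- The point `b_n` of `|𝕂(n)|`. -/
noncomputable def Associahedron.apex (n : ℕ) (hn : 2 ≤ n) : Associahedron n :=
  ⟨bary n, 0, _, .apex hn, 0, rfl⟩

/-- The face operator `∂_k : |𝕂(r)| × |𝕂(s)| → |𝕂(n)|`, `r + s = n + 1`, `r, s ≥ 2`. -/
def Associahedron.face {n r s : ℕ} (hn : r + s = n + 1) (hr : 2 ≤ r) (hs : 2 ≤ s) (k : Fin r)
    (ρ : Associahedron r) (σ : Associahedron s) : Associahedron n :=
  ⟨faceMap hn k ρ.val σ.val, by
    obtain ⟨q₁, π₁, h₁, x₁, e₁⟩ := ρ.mem_cell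
    obtain ⟨q₂, π₂, h₂, x₂, e₂⟩ := σ.mem_cell
    refine ⟨_, _, .face hn hr hs k h₁ h₂, WithLp.toLp 2 (Fin.append x₁ x₂), ?_⟩
    simp [faceChart, ← e₁, ← e₂]⟩

/-! ### h-unital smooth `A_∞`-categories -/

section AInfty

variable {G X : Type*} [DiffeologicalSpace G] [DiffeologicalSpace X]

/-- A smooth `A_∞`-form on an internal precategory `(G, X)`: smooth maps
`M(n) : |𝕂(n)| × G^n → G`, `n ≥ 2`, compatible with sources and targets and satisfying
`M(n)(∂_k(ρ, σ); g_1, …, g_n) = M(r)(ρ; g_1, …, M(s)(σ; g_k, …, g_{k+s-1}), …, g_n)`. -/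
structure AInftyForm (C : InternalPrecategory G X) where
  /-- The maps `M(n)`; for `n < 2` the space `|𝕂(n)|` is empty, so there is no datum there. -/
  M : (n : ℕ) → Associahedron n × Chain C n → G
  smooth : ∀ n, 2 ≤ n → DSmooth (M n)
  src_M : ∀ (n : ℕ) (hn : 2 ≤ n) (τ : Associahedron n) (g : Chain C n),
    C.src (M n (τ, g)) = C.src (g.1 ⟨0, by omega⟩)
  tgt_M : ∀ (n : ℕ) (hn : 2 ≤ n) (τ : Associahedron n) (g : Chain C n),
    C.tgt (M n (τ, g)) = C.tgt (g.1 ⟨n - 1, by omega⟩)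
  assoc : ∀ {n r s : ℕ} (hn : r + s = n + 1) (hr : 2 ≤ r) (hs : 2 ≤ s) (k : Fin r)
    (ρ : Associahedron r) (σ : Associahedron s) (g : Chain C n),
    M n (Associahedron.face hn hr hs k ρ σ, g) =
      M r (ρ, g.graft hn hs k (M s (σ, g.sub hn k)) (src_M s hs σ _) (tgt_M s hs σ _))

/-- Smooth homotopy of maps `f, f' : G → G` over `X × X`. It is parametrised by the quotient
`ℝ / π_set` (the interval `[0, 1]`), that is, it is a smooth map `H : G × ℝ → G` with
`H(g, π_set t) = H(g, t)`, and it fixes sources and targets. -/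
def HomotopicOver (C : InternalPrecategory G X) (f f' : G → G) : Prop :=
  ∃ H : G × ℝ → G, DSmooth H ∧
    (∀ g t, H (g, clamp t) = H (g, t)) ∧
    (∀ g, H (g, 0) = f g) ∧ (∀ g, H (g, 1) = f' g) ∧
    ∀ g t, C.src (H (g, t)) = C.src g ∧ C.tgt (H (g, t)) = C.tgt g

/-- `(G, X)` is an internal h-unital smooth `A_∞`-category: it has a smooth `A_∞`-form such that
multiplication by units on either side, `g ↦ M(2)(b_2; e, g)` and `g ↦ M(2)(b_2; g, e)`, is
smoothly homotopic to the identity. -/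
def IsHUnitalAInftyCategory (C : InternalPrecategory G X) : Prop :=
  ∃ A : AInftyForm C,
    HomotopicOver C
      (fun g ↦ A.M 2 (.apex 2 le_rfl, .pair (C.unit (C.src g)) g (C.tgt_unit _))) id ∧
    HomotopicOver C
      (fun g ↦ A.M 2 (.apex 2 le_rfl, .pair g (C.unit (C.tgt g)) (C.src_unit _).symm)) id

end AInfty

end SmoothAInfty

/-! A chain of `n` paths has an obvious concatenation on `[0, n]`, but in a general diffeological
space it need not be smooth at the integers. It becomes smooth after precomposition with any smooth
`φ : ℝ → [0, n]` which, locally in time, stays in one slot `[i, i + 1]`: there the composite is a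
single path of the chain, reparametrised, and plots are local. `SlotSmoothAt` is this condition for
families, and `dSmooth_total` is its consequence.

It therefore suffices to attach to each `ρ ∈ |𝕂(n)|` a reparametrisation `φ_ρ : [0, 1] → [0, n]`,
slot-smooth along plots, such that the face `∂_k(ρ, σ)` receives `ins k φ_σ ∘ φ_ρ`. The `A_∞`
relation is then an identity of concatenations (`total_graft`).

The `φ_ρ` are built by induction over cells. The centre receives a staircase which is flat near the
integers, and `joinReparam` interpolates between a face and the centre. Moving `φ` linearly to
`stair n ∘ φ` never leaves a slot; afterwards the argument of the staircase may move across slots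
freely, because the staircase is flat near the integers.

The delicate point is that a point of the polyhedron lies in many cells. In partial sum coordinates
`|𝕂(n)|` lies in a polytope. The join coordinate of a point is determined because the centre
satisfies the defining inequalities strictly, and two faces through one point belong to nested or
disjoint intervals. These two cases are settled by the two operadic associativity laws of `ins`,
which gives uniqueness (`HasReparam.unique`).

For `n = 2`, multiplication by a unit is precomposition with a smooth self-map of `ℝ` preserving
both `(-∞, 0]` and `[1, ∞)`, and this map is linearly homotopic to the identity. -/

namespace SmoothAInfty

open Diffeology
open Real (smoothTransition)
open scoped Topology

/-! ### Reparametrisations -/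

/-- A smooth step: `0` on `(-∞, 1/3]` and `1` on `[2/3, ∞)`. -/
noncomputable def step (x : ℝ) : ℝ := smoothTransition (3 * x - 1)

lemma contDiff_step : ContDiff ℝ ∞ step :=
  (Real.smoothTransition.contDiff (n := ⊤)).comp (by fun_prop)

lemma step_of_le {x : ℝ} (h : x ≤ 1 / 3) : step x = 0 :=
  Real.smoothTransition.zero_of_nonpos (by linarith)

lemma step_of_ge {x : ℝ} (h : 2 / 3 ≤ x) : step x = 1 :=
  Real.smoothTransition.one_of_one_le (by linarith)

/-- The smooth staircase `[0, n] → [0, n]` preserving every interval `[i, i + 1]` and constant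
near the integers. -/
noncomputable def stair (n : ℕ) (v : ℝ) : ℝ := ∑ i ∈ Finset.range n, step (v - i)

lemma contDiff_stair (n : ℕ) : ContDiff ℝ ∞ (stair n) :=
  ContDiff.sum fun _ _ ↦ contDiff_step.comp (by fun_prop)

lemma stair_of_ge {n : ℕ} {v : ℝ} (h : n - 1 / 3 ≤ v) : stair n v = n := by
  rw [stair, Finset.sum_congr rfl (g := fun _ ↦ (1 : ℝ)) fun i hi ↦ ?_]
  · simp
  · have : (i : ℝ) + 1 ≤ n := by exact_mod_cast Finset.mem_range.1 hi
    exact step_of_ge (by linarith)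

lemma stair_of_le {n : ℕ} {v : ℝ} (h : v ≤ 1 / 3) : stair n v = 0 :=
  Finset.sum_eq_zero fun i _ ↦ step_of_le (by have : (0 : ℝ) ≤ i := i.cast_nonneg; linarith)

lemma stair_eq {n i : ℕ} (hi : i < n) {v : ℝ} (h₁ : i - 1 / 3 ≤ v) (h₂ : v ≤ i + 4 / 3) :
    stair n v = i + step (v - i) := by
  induction n, hi using Nat.le_induction with
  | base => rw [stair, Finset.sum_range_succ]; exact congrArg (· + _) (stair_of_ge h₁)
  | succ m hm ih =>
    have : (i : ℝ) + 1 ≤ m := by exact_mod_cast hm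
    rw [stair, Finset.sum_range_succ, step_of_le (x := v - m) (by linarith), add_zero]
    exact ih

/-- The flat stretches leave a margin: even the slot enlarged by `1/3` on both sides is sent into
the slot. Hence composing with the staircase makes any continuous family locally slot-valued. -/
lemma stair_mem {n i : ℕ} (hi : i < n) {v : ℝ} (h₁ : i - 1 / 3 ≤ v) (h₂ : v ≤ i + 4 / 3) :
    stair n v ∈ Set.Icc (i : ℝ) (i + 1) := by
  rw [stair_eq hi h₁ h₂]
  have h₃ : 0 ≤ step (v - i) := Real.smoothTransition.nonneg _
  have h₄ : step (v - i) ≤ 1 := Real.smoothTransition.le_one _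
  constructor <;> linarith

lemma exists_slot {n : ℕ} (hn : 0 < n) {v : ℝ} (h : v ∈ Set.Icc (0 : ℝ) n) :
    ∃ i < n, v ∈ Set.Icc (i : ℝ) (i + 1) := by
  rcases h.2.lt_or_eq with h' | rfl
  · exact ⟨⌊v⌋₊, (Nat.floor_lt h.1).2 h', Nat.floor_le h.1, (Nat.lt_floor_add_one v).le⟩
  · refine ⟨n - 1, by omega, ?_⟩
    rw [Nat.cast_pred hn]
    constructor <;> linarith

/-- A reparametrisation `[0, 1] → [0, n]`, extended to `ℝ` by constants. -/
structure IsReparam (n : ℕ) (φ : ℝ → ℝ) : Prop where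
  of_nonpos : ∀ t ≤ 0, φ t = 0
  of_one_le : ∀ t, 1 ≤ t → φ t = n
  mem_Icc : ∀ t, φ t ∈ Set.Icc (0 : ℝ) n

lemma IsReparam.clamp {n : ℕ} {φ : ℝ → ℝ} (h : IsReparam n φ) (t : ℝ) : φ (clamp t) = φ t := by
  unfold SmoothAInfty.clamp
  rcases le_total t 0 with h₀ | h₀
  · rw [max_eq_left ((min_le_right _ _).trans h₀), h.of_nonpos _ h₀, h.of_nonpos _ le_rfl]
  · rcases le_total t 1 with h₁ | h₁
    · rw [min_eq_right h₁, max_eq_right h₀]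
    · rw [min_eq_left h₁, max_eq_right zero_le_one, h.of_one_le _ h₁, h.of_one_le _ le_rfl]

/-- The map `[0, r] → [0, r + s - 1]` which stretches the slot `[k, k + 1]` by `ψ` and shifts
the later slots. -/
noncomputable def ins (k : ℕ) (ψ : ℝ → ℝ) (v : ℝ) : ℝ := min v k + ψ (v - k) + max (v - (k + 1)) 0

lemma ins_of_le {s : ℕ} {ψ : ℝ → ℝ} (hψ : IsReparam s ψ) {k : ℕ} {v : ℝ} (h : v ≤ k) :
    ins k ψ v = v := by
  rw [ins, min_eq_left h, hψ.of_nonpos _ (by linarith), max_eq_right (by linarith)]; ring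

lemma ins_of_mem (ψ : ℝ → ℝ) {k : ℕ} {v : ℝ} (h₁ : k ≤ v) (h₂ : v ≤ k + 1) :
    ins k ψ v = k + ψ (v - k) := by
  rw [ins, min_eq_right h₁, max_eq_right (by linarith)]; ring

lemma ins_of_ge {s : ℕ} {ψ : ℝ → ℝ} (hψ : IsReparam s ψ) {k : ℕ} {v : ℝ} (h : k + 1 ≤ v) :
    ins k ψ v = v + (s - 1) := by
  rw [ins, min_eq_right (by linarith), hψ.of_one_le _ (by linarith), max_eq_left (by linarith)]
  ring

lemma IsReparam.ins_comp {n r s k : ℕ} {φ ψ : ℝ → ℝ} (hφ : IsReparam r φ) (hψ : IsReparam s ψ)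
    (hn : r + s = n + 1) (hk : k < r) : IsReparam n (ins k ψ ∘ φ) := by
  have hn' : (r : ℝ) + s = n + 1 := by exact_mod_cast hn
  have hk' : (k : ℝ) + 1 ≤ r := by exact_mod_cast hk
  have hk0 : (0 : ℝ) ≤ k := k.cast_nonneg
  refine ⟨fun t ht ↦ ?_, fun t ht ↦ ?_, fun t ↦ ?_⟩
  · rw [Function.comp, hφ.of_nonpos t ht, ins_of_le hψ hk0]
  · rw [Function.comp, hφ.of_one_le t ht, ins_of_ge hψ hk']; linarith
  · obtain ⟨h₀, h₁⟩ := hφ.mem_Icc t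
    have hs : (0 : ℝ) ≤ s := s.cast_nonneg
    rw [Function.comp]
    rcases le_total (φ t) k with h | h
    · obtain ⟨h₂, h₃⟩ := hψ.mem_Icc (φ t - k)
      rw [ins_of_le hψ h]; constructor <;> linarith
    rcases le_total (φ t) (k + 1) with h' | h'
    · obtain ⟨h₂, h₃⟩ := hψ.mem_Icc (φ t - k)
      rw [ins_of_mem ψ h h']; constructor <;> linarith
    · rw [ins_of_ge hψ h']; constructor <;> linarith

/-- Sequential operadic associativity of insertions. -/
lemma ins_ins_comp {s s' k j : ℕ} {ψ χ : ℝ → ℝ} (hψ : IsReparam s ψ) (hχ : IsReparam s' χ)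
    (hj : j < s) (v : ℝ) : ins k (ins j χ ∘ ψ) v = ins (k + j) χ (ins k ψ v) := by
  have hj' : (j : ℝ) + 1 ≤ s := by exact_mod_cast hj
  have hj0 : (0 : ℝ) ≤ j := j.cast_nonneg
  have hc : IsReparam (s + s' - 1) (ins j χ ∘ ψ) := hψ.ins_comp hχ (by omega) hj
  have hs : ((s + s' - 1 : ℕ) : ℝ) = s + s' - 1 := by
    rw [Nat.cast_sub (by omega)]; push_cast; ring
  rcases le_total v k with h | h
  · rw [ins_of_le hc h, ins_of_le hψ h, ins_of_le hχ (by push_cast; linarith)]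
  rcases le_total v (k + 1) with h' | h'
  · rw [ins_of_mem _ h h', ins_of_mem ψ h h', Function.comp]
    set w := ψ (v - k)
    unfold ins
    push_cast
    rw [show (k : ℝ) + w - (k + j) = w - j by ring,
      show (k : ℝ) + w - (k + j + 1) = w - (j + 1) by ring, min_add_add_left]
    ring
  · rw [ins_of_ge hc h', ins_of_ge hψ h', ins_of_ge hχ (by push_cast; linarith), hs]; ring

/-- Parallel operadic associativity of insertions. -/
lemma ins_ins_of_lt {s s' k m : ℕ} {ψ χ : ℝ → ℝ} (hψ : IsReparam s ψ) (hχ : IsReparam s' χ)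
    (hs : 1 ≤ s) (hkm : k < m) (v : ℝ) :
    ins k ψ (ins m χ v) = ins (m + s - 1) χ (ins k ψ v) := by
  have hm : ((m + s - 1 : ℕ) : ℝ) = m + s - 1 := by
    rw [Nat.cast_sub (by omega)]; push_cast; ring
  have hk' : (k : ℝ) + 1 ≤ m := by exact_mod_cast hkm
  have hs' : (1 : ℝ) ≤ s := by exact_mod_cast hs
  have hs0 : (0 : ℝ) ≤ s' := s'.cast_nonneg
  rcases le_total v k with h | h
  · rw [ins_of_le hχ (by linarith), ins_of_le hψ h, ins_of_le hχ (by linarith)]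
  rcases le_total v (k + 1) with h' | h'
  · rw [ins_of_le hχ (by linarith), ins_of_mem ψ h h', ins_of_le hχ]
    have := (hψ.mem_Icc (v - k)).2
    linarith
  rw [ins_of_ge hψ h']
  rcases le_total v m with h₂ | h₂
  · rw [ins_of_le hχ h₂, ins_of_ge hψ h', ins_of_le hχ (by linarith)]
  rcases le_total v (m + 1) with h₃ | h₃
  · rw [ins_of_mem χ h₂ h₃, ins_of_mem χ (by linarith) (by linarith), ins_of_ge hψ, hm]
    · rw [show v + (s - 1) - (m + s - 1) = v - m by ring]; ring
    · have := (hχ.mem_Icc (v - m)).1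
      linarith
  · rw [ins_of_ge hχ h₃, ins_of_ge hχ (by linarith), ins_of_ge hψ (by linarith)]; ring

/-- The reparametrisation attached to the point `b_n`. -/
noncomputable def apexReparam (n : ℕ) (t : ℝ) : ℝ := stair n (n * smoothTransition t)

/-- The reparametrisation attached to a point `(1 - c) x + c b_n` of a join: `φ` is first
composed with a homotopy from the identity to the staircase (for `c ≤ 1 / 3`), and then moved
linearly below the staircase to the reparametrisation of `b_n` (for `2 / 3 ≤ c`). -/
noncomputable def joinReparam (n : ℕ) (c : ℝ) (φ : ℝ → ℝ) (t : ℝ) : ℝ :=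
  (1 - smoothTransition (3 * c)) * ((1 - smoothTransition (3 * c - 2)) * φ t +
      smoothTransition (3 * c - 2) * (n * smoothTransition t)) +
    smoothTransition (3 * c) * stair n ((1 - smoothTransition (3 * c - 2)) * φ t +
      smoothTransition (3 * c - 2) * (n * smoothTransition t))

lemma joinReparam_zero (n : ℕ) (φ : ℝ → ℝ) : joinReparam n 0 φ = φ := by
  funext t
  simp [joinReparam, Real.smoothTransition.zero_of_nonpos (show (-2 : ℝ) ≤ 0 by norm_num)]

/-- The base of the join collapses at the cone point, so the dependence on `φ` has to disappear
there. -/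
lemma joinReparam_one (n : ℕ) (φ : ℝ → ℝ) : joinReparam n 1 φ = apexReparam n := by
  funext t
  rw [joinReparam, apexReparam, Real.smoothTransition.one_of_one_le (x := 3 * 1) (by norm_num),
    Real.smoothTransition.one_of_one_le (x := 3 * 1 - 2) (by norm_num)]
  simp

/-- Both cutoffs are already constant outside `[0, 1]`. The non-smooth clamping in the chart of a
join can therefore be dropped, and the family is smooth in the raw coordinate. -/
lemma joinReparam_clamp (n : ℕ) (c : ℝ) (φ : ℝ → ℝ) :
    joinReparam n (clamp c) φ = joinReparam n c φ := by
  have h₁ : smoothTransition (3 * clamp c) = smoothTransition (3 * c) ∧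
      smoothTransition (3 * clamp c - 2) = smoothTransition (3 * c - 2) := by
    unfold clamp
    rcases le_total c 0 with h | h
    · rw [max_eq_left ((min_le_right _ _).trans h)]
      constructor <;>
      rw [Real.smoothTransition.zero_of_nonpos (by linarith),
        Real.smoothTransition.zero_of_nonpos (by linarith)]
    rcases le_total c 1 with h' | h'
    · rw [min_eq_right h', max_eq_right h]; exact ⟨rfl, rfl⟩
    · rw [min_eq_left h', max_eq_right zero_le_one]
      constructor <;>
      rw [Real.smoothTransition.one_of_one_le (by linarith),
        Real.smoothTransition.one_of_one_le (by linarith)]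
  funext t
  rw [joinReparam, joinReparam, h₁.1, h₁.2]

lemma convex_mem {a x y l u : ℝ} (h₀ : 0 ≤ a) (h₁ : a ≤ 1) (hx : x ∈ Set.Icc l u)
    (hy : y ∈ Set.Icc l u) : (1 - a) * x + a * y ∈ Set.Icc l u :=
  convex_Icc l u hx hy (by linarith) h₀ (by ring)

lemma stair_mem_Icc (n : ℕ) (v : ℝ) : stair n v ∈ Set.Icc (0 : ℝ) n := by
  refine ⟨Finset.sum_nonneg fun i _ ↦ Real.smoothTransition.nonneg _, ?_⟩
  calc stair n v ≤ ∑ i ∈ Finset.range n, (1 : ℝ) :=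
        Finset.sum_le_sum fun i _ ↦ Real.smoothTransition.le_one _
    _ = n := by simp

lemma IsReparam.join {n : ℕ} {φ : ℝ → ℝ} (hφ : IsReparam n φ) (c : ℝ) :
    IsReparam n (joinReparam n c φ) := by
  refine ⟨fun t ht ↦ ?_, fun t ht ↦ ?_, fun t ↦ ?_⟩
  · simp [joinReparam, hφ.of_nonpos t ht, Real.smoothTransition.zero_of_nonpos ht,
      stair_of_le (n := n) (v := 0) (by norm_num)]
  · have (b : ℝ) : (1 - b) * n + b * (n * 1) = n := by ring
    rw [joinReparam, hφ.of_one_le t ht, Real.smoothTransition.one_of_one_le ht, this,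
      stair_of_ge (by linarith)]
    ring
  · have hn : (0 : ℝ) ≤ n := n.cast_nonneg
    refine convex_mem (Real.smoothTransition.nonneg _) (Real.smoothTransition.le_one _)
      (convex_mem (Real.smoothTransition.nonneg _) (Real.smoothTransition.le_one _)
        (hφ.mem_Icc t) ⟨mul_nonneg hn (Real.smoothTransition.nonneg _),
          mul_le_of_le_one_right hn (Real.smoothTransition.le_one _)⟩) (stair_mem_Icc _ _)

lemma IsReparam.apex (n : ℕ) : IsReparam n (apexReparam n) := by
  refine ⟨fun t ht ↦ ?_, fun t ht ↦ ?_, fun t ↦ stair_mem_Icc _ _⟩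
  · rw [apexReparam, Real.smoothTransition.zero_of_nonpos ht, mul_zero, stair_of_le (by norm_num)]
  · rw [apexReparam, Real.smoothTransition.one_of_one_le ht, mul_one, stair_of_ge (by linarith)]

/-! ### Smooth families of reparametrisations -/

/-- A family of maps `ℝ → ℝ` which near `(x, t)` is smooth and takes values in a single interval
`[i, i + 1]` with `i < n`. -/
def SlotSmoothAt {E : Type*} [NormedAddCommGroup E] [NormedSpace ℝ E] (n : ℕ) (h : E → ℝ → ℝ)
    (x : E) (t : ℝ) : Prop :=
  ContDiffAt ℝ ∞ (fun z : E × ℝ ↦ h z.1 z.2) (x, t) ∧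
    ∃ i < n, ∀ᶠ z : E × ℝ in 𝓝 (x, t), h z.1 z.2 ∈ Set.Icc (i : ℝ) (i + 1)

section SlotSmooth

variable {E F : Type*} [NormedAddCommGroup E] [NormedSpace ℝ E] [NormedAddCommGroup F]
  [NormedSpace ℝ F]

lemma SlotSmoothAt.congr {n : ℕ} {h h' : E → ℝ → ℝ} {x : E} {t : ℝ} (hs : SlotSmoothAt n h x t)
    (he : ∀ᶠ z : E × ℝ in 𝓝 (x, t), h' z.1 z.2 = h z.1 z.2) : SlotSmoothAt n h' x t := by
  obtain ⟨i, hi, hm⟩ := hs.2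
  refine ⟨hs.1.congr_of_eventuallyEq he, i, hi, ?_⟩
  filter_upwards [he, hm] with z h₁ h₂
  rwa [h₁]

lemma SlotSmoothAt.comp {n : ℕ} {h : F → ℝ → ℝ} {f : E → F} {u : E → ℝ → ℝ} {x : E} {t : ℝ}
    (hs : SlotSmoothAt n h (f x) (u x t)) (hf : ContDiffAt ℝ ∞ f x)
    (hu : ContDiffAt ℝ ∞ (fun z : E × ℝ ↦ u z.1 z.2) (x, t)) :
    SlotSmoothAt n (fun x t ↦ h (f x) (u x t)) x t := by
  have hc : ContDiffAt ℝ ∞ (fun z : E × ℝ ↦ (f z.1, u z.1 z.2)) (x, t) :=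
    (ContDiffAt.comp (x, t) hf contDiffAt_fst).prodMk hu
  obtain ⟨i, hi, hm⟩ := hs.2
  exact ⟨ContDiffAt.comp (x, t) (g := fun z : F × ℝ ↦ h z.1 z.2) hs.1 hc, i, hi,
    hc.continuousAt.eventually hm⟩

/-- The map `ins k ψ` may have kinks at `k` and `k + 1`, but `h₁` locally stays in one slot and so
meets only one of the three branches. In the middle branch the new slot is supplied by `h₂`. -/
lemma SlotSmoothAt.ins_comp {n r s k : ℕ} {h₁ h₂ : E → ℝ → ℝ} {x : E} {t : ℝ}
    (hs₁ : SlotSmoothAt r h₁ x t) (hs₂ : ∀ u, SlotSmoothAt s h₂ x u)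
    (hr : ∀ x, IsReparam s (h₂ x)) (hs : 1 ≤ s) (hn : r + s = n + 1) (hk : k < r) :
    SlotSmoothAt n (fun x ↦ ins k (h₂ x) ∘ h₁ x) x t := by
  obtain ⟨i, hi, hm⟩ := hs₁.2
  rcases lt_trichotomy i k with hik | rfl | hik
  · have hik' : (i : ℝ) + 1 ≤ k := by exact_mod_cast hik
    refine SlotSmoothAt.congr (h := h₁) ⟨hs₁.1, i, by omega, hm⟩ ?_
    filter_upwards [hm] with z hz
    exact ins_of_le (hr _) (hz.2.trans hik')
  · have hsub : ContDiffAt ℝ ∞ (fun z : E × ℝ ↦ h₁ z.1 z.2 - i) (x, t) :=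
      hs₁.1.sub contDiffAt_const
    have hc := (hs₂ (h₁ x t - i)).comp (f := id) (u := fun x t ↦ h₁ x t - i) contDiffAt_id hsub
    obtain ⟨j, hj, hmj⟩ := hc.2
    refine SlotSmoothAt.congr (h := fun x t ↦ i + h₂ x (h₁ x t - i))
      ⟨contDiffAt_const.add hc.1, i + j, by omega, ?_⟩ ?_
    · filter_upwards [hmj] with z hz
      push_cast
      simp only [id] at hz
      constructor <;> linarith [hz.1, hz.2]
    · filter_upwards [hm] with z hz
      exact ins_of_mem _ hz.1 hz.2
  · have hik' : (k : ℝ) + 1 ≤ i := by exact_mod_cast hik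
    refine SlotSmoothAt.congr (h := fun x t ↦ h₁ x t + (s - 1))
      ⟨hs₁.1.add contDiffAt_const, i + s - 1, by omega, ?_⟩ ?_
    · filter_upwards [hm] with z hz
      rw [Nat.cast_sub (by omega)]
      push_cast
      constructor <;> linarith [hz.1, hz.2]
    · filter_upwards [hm] with z hz
      exact ins_of_ge (hr _) (hik'.trans hz.1)

/-- No slot condition is imposed on `w`: the margin in `stair_mem` absorbs small movements across
integers. -/
lemma slotSmoothAt_stair {n : ℕ} (hn : 0 < n) {w : E → ℝ → ℝ} {x : E} {t : ℝ}
    (hw : ContDiffAt ℝ ∞ (fun z : E × ℝ ↦ w z.1 z.2) (x, t)) (hm : w x t ∈ Set.Icc (0 : ℝ) n) :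
    SlotSmoothAt n (fun x t ↦ stair n (w x t)) x t := by
  obtain ⟨i, hi, h₁, h₂⟩ := exists_slot hn hm
  refine ⟨ContDiffAt.comp (x, t) (g := stair n) (contDiff_stair n).contDiffAt hw, i, hi, ?_⟩
  have hI : Set.Icc ((i : ℝ) - 1 / 3) (i + 4 / 3) ∈ 𝓝 (w x t) :=
    Icc_mem_nhds (by linarith) (by linarith)
  filter_upwards [hw.continuousAt.eventually hI] with z hz
  exact stair_mem hi hz.1 hz.2

lemma contDiffAt_smoothTransition_comp {G : Type*} [NormedAddCommGroup G] [NormedSpace ℝ G]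
    {f : G → ℝ} {x : G} (hf : ContDiffAt ℝ ∞ f x) :
    ContDiffAt ℝ ∞ (fun y ↦ smoothTransition (f y)) x :=
  ContDiffAt.comp x (Real.smoothTransition.contDiff (n := ⊤)).contDiffAt hf

lemma SlotSmoothAt.join {n : ℕ} (hn : 0 < n) {h : E → ℝ → ℝ} {c : E → ℝ} {x : E} {t : ℝ}
    (hs : SlotSmoothAt n h x t) (hr : IsReparam n (h x)) (hc : ContDiffAt ℝ ∞ c x) :
    SlotSmoothAt n (fun x ↦ joinReparam n (c x) (h x)) x t := by
  have hc' : ContDiffAt ℝ ∞ (fun z : E × ℝ ↦ c z.1) (x, t) :=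
    ContDiffAt.comp (x, t) hc contDiffAt_fst
  have ha : ContDiffAt ℝ ∞ (fun z : E × ℝ ↦ smoothTransition (3 * c z.1)) (x, t) :=
    contDiffAt_smoothTransition_comp (contDiffAt_const.mul hc')
  have hb : ContDiffAt ℝ ∞ (fun z : E × ℝ ↦ smoothTransition (3 * c z.1 - 2)) (x, t) :=
    contDiffAt_smoothTransition_comp ((contDiffAt_const.mul hc').sub contDiffAt_const)
  have he : ContDiffAt ℝ ∞ (fun z : E × ℝ ↦ (n : ℝ) * smoothTransition z.2) (x, t) :=
    contDiffAt_const.mul (contDiffAt_smoothTransition_comp contDiffAt_snd)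
  have hcont := hc'.continuousAt
  -- Below `2/3` the second cutoff vanishes, and `φ` moves towards `stair n ∘ φ` within its slot.
  -- Above `1/3` the first cutoff is `1`, and everything passes through the staircase. The two open
  -- regimes cover all values of `c`.
  rcases lt_or_ge (c x) (2 / 3) with hlt | hge
  · obtain ⟨i, hi, hm⟩ := hs.2
    refine SlotSmoothAt.congr (h := fun x t ↦ (1 - smoothTransition (3 * c x)) * h x t +
      smoothTransition (3 * c x) * stair n (h x t)) ⟨?_, i, hi, ?_⟩ ?_
    · exact ((contDiffAt_const.sub ha).mul hs.1).add
        (ha.mul (ContDiffAt.comp (x, t) (g := stair n) (contDiff_stair n).contDiffAt hs.1))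
    · filter_upwards [hm] with z hz
      exact convex_mem (Real.smoothTransition.nonneg _) (Real.smoothTransition.le_one _) hz
        (stair_mem hi (by linarith [hz.1]) (by linarith [hz.2]))
    · filter_upwards [hcont.eventually_lt_const hlt] with z hz
      simp only [joinReparam, Real.smoothTransition.zero_of_nonpos
        (show 3 * c z.1 - 2 ≤ 0 by linarith)]
      simp
  · refine SlotSmoothAt.congr (slotSmoothAt_stair hn
      (w := fun x t ↦ (1 - smoothTransition (3 * c x - 2)) * h x t +
        smoothTransition (3 * c x - 2) * (n * smoothTransition t))
      (((contDiffAt_const.sub hb).mul hs.1).add (hb.mul he)) ?_) ?_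
    · have hn : (0 : ℝ) ≤ n := n.cast_nonneg
      exact convex_mem (Real.smoothTransition.nonneg _) (Real.smoothTransition.le_one _)
        (hr.mem_Icc t) ⟨mul_nonneg hn (Real.smoothTransition.nonneg _),
          mul_le_of_le_one_right hn (Real.smoothTransition.le_one _)⟩
    · filter_upwards [hcont.eventually_const_lt (show 1 / 3 < c x by linarith)] with z hz
      simp only [joinReparam, Real.smoothTransition.one_of_one_le
        (show 1 ≤ 3 * c z.1 by linarith)]
      simp

lemma slotSmoothAt_apex {n : ℕ} (hn : 0 < n) (x : E) (t : ℝ) :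
    SlotSmoothAt n (fun _ : E ↦ apexReparam n) x t :=
  slotSmoothAt_stair hn (w := fun _ t ↦ n * smoothTransition t)
    (contDiffAt_const.mul (contDiffAt_smoothTransition_comp contDiffAt_snd))
    ⟨mul_nonneg n.cast_nonneg (Real.smoothTransition.nonneg _),
      mul_le_of_le_one_right n.cast_nonneg (Real.smoothTransition.le_one _)⟩

end SlotSmooth

/-! ### The associahedron in partial sum coordinates -/

/-- The polytope `K_n` in the coordinates `S i = t_1 + ⋯ + t_i`, extended by constants. -/
structure InPoly (n : ℕ) (S : ℕ → ℝ) : Prop where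
  zero : S 0 = 0
  one : S 1 = 0
  mono : Monotone S
  le : ∀ i, S (i + 1) ≤ i
  top : ∀ i, n ≤ i → S i = n - 1

/-- The point lies on the face corresponding to the interval `[k, k + s)`. -/
structure OnFace (n k s : ℕ) (S : ℕ → ℝ) : Prop where
  le_n : k + s ≤ n
  two_le : 2 ≤ s
  lt_n : s < n
  base : S (k + 1) = S k
  lt : ∀ j, j + 1 < s → S (k + (j + 1)) - S k ≤ j
  top : (s : ℝ) - 1 ≤ S (k + s) - S k

/-- The first factor of a point on a face. -/
def outer (k s : ℕ) (S : ℕ → ℝ) (i : ℕ) : ℝ := if i ≤ k then S i else S (i + s - 1) - (s - 1)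

/-- The second factor of a point on a face. -/
def inner (k s : ℕ) (S : ℕ → ℝ) (j : ℕ) : ℝ := if j < s then S (k + j) - S k else s - 1

/-- The partial sums of `bary n`. -/
noncomputable def baryS (n i : ℕ) : ℝ :=
  if i = 0 then 0 else if i < n then ((i : ℝ) - 1) / 2 else n - 1

lemma outer_of_le {k s i : ℕ} (S : ℕ → ℝ) (h : i ≤ k) : outer k s S i = S i := if_pos h

lemma outer_of_gt {k s i : ℕ} (S : ℕ → ℝ) (h : k < i) : outer k s S i = S (i + s - 1) - (s - 1) :=
  if_neg h.not_ge

lemma inner_of_lt {k s j : ℕ} (S : ℕ → ℝ) (h : j < s) : inner k s S j = S (k + j) - S k := if_pos h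

lemma inner_of_ge {k s j : ℕ} (S : ℕ → ℝ) (h : s ≤ j) : inner k s S j = s - 1 :=
  if_neg h.not_gt

/-! ### Factors of a point on a face, and pairs of faces through one point. -/

namespace OnFace

variable {n k s : ℕ} {S : ℕ → ℝ}

lemma outer_mem (h : OnFace n k s S) (hS : InPoly n S) {r : ℕ} (hr : r + s = n + 1) :
    InPoly r (outer k s S) := by
  have := h.le_n
  have := h.two_le
  have hr' : (r : ℝ) + s = n + 1 := by exact_mod_cast hr
  refine ⟨?_, ?_, monotone_nat_of_le_succ fun i ↦ ?_, fun i ↦ ?_, fun i hi ↦ ?_⟩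
  · rw [outer_of_le S (Nat.zero_le k), hS.zero]
  · rcases Nat.eq_zero_or_pos k with rfl | hk
    · rw [outer_of_gt S one_pos, show 1 + s - 1 = s by omega]
      have h₁ := h.top
      have h₂ := hS.le (s - 1)
      rw [hS.zero, zero_add] at h₁
      rw [show s - 1 + 1 = s by omega, Nat.cast_sub (by omega)] at h₂
      push_cast at h₂
      linarith
    · rw [outer_of_le S hk, hS.one]
  · rcases lt_trichotomy i k with hk | rfl | hk
    · rw [outer_of_le S hk.le, outer_of_le S hk]
      exact hS.mono (Nat.le_succ i)
    · rw [outer_of_le S le_rfl, outer_of_gt S (Nat.lt_succ_self i),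
        show i + 1 + s - 1 = i + s by omega]
      linarith [h.top]
    · rw [outer_of_gt S hk, outer_of_gt S (by omega)]
      linarith [hS.mono (show i + s - 1 ≤ i + 1 + s - 1 by omega)]
  · rcases lt_or_ge k (i + 1) with hk | hk
    · rw [outer_of_gt S hk]
      have h₂ := hS.le (i + s - 1)
      rw [Nat.cast_sub (by omega), show i + s - 1 + 1 = i + 1 + s - 1 by omega] at h₂
      push_cast at h₂
      linarith
    · rw [outer_of_le S hk]; exact hS.le i
  · rw [outer_of_gt S (by omega), hS.top _ (by omega)]
    linarith

lemma inner_mem (h : OnFace n k s S) (hS : InPoly n S) : InPoly s (inner k s S) := by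
  have hs := h.two_le
  refine ⟨?_, ?_, monotone_nat_of_le_succ fun i ↦ ?_, fun i ↦ ?_, fun i hi ↦ inner_of_ge S hi⟩
  · rw [inner_of_lt S (by omega)]; simp
  · rw [inner_of_lt S (by omega), h.base, sub_self]
  · rcases lt_trichotomy (i + 1) s with hi | hi | hi
    · rw [inner_of_lt S (by omega), inner_of_lt S hi]
      linarith [hS.mono (show k + i ≤ k + (i + 1) by omega)]
    · rw [inner_of_lt S (by omega), inner_of_ge S hi.ge]
      have := h.lt (i - 1) (by omega)
      rw [show i - 1 + 1 = i by omega, Nat.cast_sub (by omega)] at this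
      rw [← hi]
      push_cast at *
      linarith
    · rw [inner_of_ge S (by omega), inner_of_ge S (by omega)]
  · rcases lt_or_ge (i + 1) s with hi | hi
    · rw [inner_of_lt S hi]; exact h.lt i hi
    · rw [inner_of_ge S hi]
      have : (s : ℝ) ≤ i + 1 := by exact_mod_cast hi
      linarith

/-- Two faces meeting in a point correspond to nested or disjoint intervals. -/
lemma not_crossing {k' s' : ℕ} (h : OnFace n k s S) (h' : OnFace n k' s' S)
    (h₁ : k < k') (h₂ : k' < k + s) (h₃ : k + s < k' + s') : False := by
  -- If the intervals crossed, the increments of `S` over `[k, k']` and `[k', k + s]` would sum to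
  -- at most `s - 2`, against the lower bound `s - 1` in `h.top`.
  have e₁ := h.lt (k' - k - 1) (by omega)
  have e₂ := h'.lt (k + s - k' - 1) (by omega)
  rw [show k + (k' - k - 1 + 1) = k' by omega] at e₁
  rw [show k' + (k + s - k' - 1 + 1) = k + s by omega] at e₂
  have e₃ : ((k' - k - 1 : ℕ) : ℝ) + (k + s - k' - 1 : ℕ) + 2 = s := by
    norm_cast; omega
  linarith [h.top]

/-- This and the next three lemmas show that the second face persists in the factors of the first,
so that a point on two faces can be factored twice. -/
lemma nested_inner {k' s' : ℕ} (h : OnFace n k s S) (h' : OnFace n k' s' S)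
    (h₁ : k ≤ k') (h₂ : k' + s' ≤ k + s) (h₃ : s' < s) :
    OnFace s (k' - k) s' (inner k s S) := by
  have hs' := h'.two_le
  refine ⟨by omega, hs', h₃, ?_, fun j hj ↦ ?_, ?_⟩
  · rw [inner_of_lt S (by omega), inner_of_lt S (by omega), show k + (k' - k + 1) = k' + 1 by omega,
      show k + (k' - k) = k' by omega, h'.base]
  · rw [inner_of_lt S (by omega), inner_of_lt S (by omega),
      show k + (k' - k + (j + 1)) = k' + (j + 1) by omega, show k + (k' - k) = k' by omega]
    linarith [h'.lt j hj]
  · rw [inner_of_lt S (show k' - k < s by omega), show k + (k' - k) = k' by omega]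
    rcases h₂.lt_or_eq with hlt | heq
    · rw [inner_of_lt S (by omega), show k + (k' - k + s') = k' + s' by omega]
      linarith [h'.top]
    -- At a common right end the inner factor has its saturated value `s - 1` rather than an
    -- increment of `S`; the bound now comes from `h.lt` at the left end of the small interval.
    · rw [inner_of_ge S (by omega)]
      have e := h.lt (k' - k - 1) (by omega)
      rw [show k + (k' - k - 1 + 1) = k' by omega] at e
      have e₃ : ((k' - k - 1 : ℕ) : ℝ) + 1 + s' = s := by norm_cast; omega
      linarith

lemma nested_outer {k' s' r' : ℕ} (h : OnFace n k s S) (h' : OnFace n k' s' S)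
    (h₁ : k ≤ k') (h₂ : k' + s' ≤ k + s) (h₃ : s' < s) (hr' : r' + s' = n + 1) :
    OnFace r' k (s - s' + 1) (outer k' s' S) := by
  have hs' := h'.two_le
  have := h.lt_n
  have := h.le_n
  have hc : ((s - s' + 1 : ℕ) : ℝ) = s - s' + 1 := by
    rw [Nat.cast_add, Nat.cast_sub h₃.le, Nat.cast_one]
  refine ⟨by omega, by omega, by omega, ?_, fun j hj ↦ ?_, ?_⟩
  · rw [outer_of_le S h₁]
    rcases h₁.lt_or_eq with hlt | rfl
    · rw [outer_of_le S hlt, h.base]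
    -- At a common left end, `h.lt` and `h'.top` bound `S (k + s') - S k` from both sides by `s' -
    -- 1`.
    · rw [outer_of_gt S (Nat.lt_succ_self k), show k + 1 + s' - 1 = k + s' by omega]
      have e := h.lt (s' - 1) (by omega)
      rw [show s' - 1 + 1 = s' by omega, Nat.cast_sub (by omega)] at e
      push_cast at e
      linarith [h'.top]
  · rw [outer_of_le S h₁]
    rcases le_or_gt (k + (j + 1)) k' with hj' | hj'
    · rw [outer_of_le S hj']; exact h.lt j (by omega)
    · rw [outer_of_gt S hj']
      have e := h.lt (j + s' - 1) (by omega)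
      rw [show k + (j + s' - 1 + 1) = k + (j + 1) + s' - 1 by omega, Nat.cast_sub (by omega)] at e
      push_cast at e
      linarith
  · rw [outer_of_le S h₁, outer_of_gt S (by omega),
      show k + (s - s' + 1) + s' - 1 = k + s by omega, hc]
    linarith [h.top]

lemma disjoint_right {k' s' r : ℕ} (h : OnFace n k s S) (h' : OnFace n k' s' S)
    (h₁ : k + s ≤ k') (hr : r + s = n + 1) : OnFace r (k' - s + 1) s' (outer k s S) := by
  have hs := h.two_le
  have hs' := h'.two_le
  have := h'.le_n
  refine ⟨by omega, hs', by omega, ?_, fun j hj ↦ ?_, ?_⟩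
  · rw [outer_of_gt S (by omega), outer_of_gt S (by omega),
      show k' - s + 1 + 1 + s - 1 = k' + 1 by omega, show k' - s + 1 + s - 1 = k' by omega, h'.base]
  · rw [outer_of_gt S (by omega), outer_of_gt S (by omega),
      show k' - s + 1 + (j + 1) + s - 1 = k' + (j + 1) by omega,
      show k' - s + 1 + s - 1 = k' by omega]
    linarith [h'.lt j hj]
  · rw [outer_of_gt S (by omega), outer_of_gt S (by omega),
      show k' - s + 1 + s' + s - 1 = k' + s' by omega,
      show k' - s + 1 + s - 1 = k' by omega]
    linarith [h'.top]

lemma disjoint_left {k' s' r' : ℕ} (h : OnFace n k s S) (h' : OnFace n k' s' S)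
    (h₁ : k + s ≤ k') (hr' : r' + s' = n + 1) : OnFace r' k s (outer k' s' S) := by
  have hs := h.two_le
  have hs' := h'.two_le
  have := h'.le_n
  refine ⟨by omega, hs, by omega, ?_, fun j hj ↦ ?_, ?_⟩
  · rw [outer_of_le S (by omega), outer_of_le S (by omega), h.base]
  · rw [outer_of_le S (by omega), outer_of_le S (by omega)]; exact h.lt j hj
  · rw [outer_of_le S h₁, outer_of_le S (by omega)]; exact h.top

end OnFace

/-! ### Iterated factors of a point on two faces. -/

section identities

variable {k s k' s' : ℕ} (S : ℕ → ℝ)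

lemma inner_inner (h₁ : k ≤ k') (h₂ : k' + s' ≤ k + s) :
    inner (k' - k) s' (inner k s S) = inner k' s' S := by
  funext j
  rcases lt_or_ge j s' with hj | hj
  · rw [inner_of_lt _ hj, inner_of_lt _ hj, inner_of_lt _ (by omega), inner_of_lt _ (by omega),
      show k + (k' - k + j) = k' + j by omega, show k + (k' - k) = k' by omega]
    ring
  · rw [inner_of_ge _ hj, inner_of_ge _ hj]

lemma outer_inner (h₁ : k ≤ k') (h₂ : k' + s' ≤ k + s) (hs' : 0 < s') :
    outer (k' - k) s' (inner k s S) = inner k (s - s' + 1) (outer k' s' S) := by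
  have hc : ((s - s' + 1 : ℕ) : ℝ) = s - s' + 1 := by
    rw [Nat.cast_add, Nat.cast_sub (by omega), Nat.cast_one]
  funext i
  rcases le_or_gt i (k' - k) with hi | hi
  · rw [outer_of_le _ hi, inner_of_lt _ (by omega), inner_of_lt _ (by omega),
      outer_of_le _ (by omega), outer_of_le _ h₁]
  · rw [outer_of_gt _ hi]
    rcases lt_or_ge i (s - s' + 1) with hi' | hi'
    · rw [inner_of_lt _ (by omega), inner_of_lt _ hi', outer_of_gt _ (by omega), outer_of_le _ h₁,
        show k + (i + s' - 1) = k + i + s' - 1 by omega]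
      ring
    · rw [inner_of_ge _ (by omega), inner_of_ge _ hi', hc]
      ring

lemma outer_outer_of_nested (h₁ : k ≤ k') (h₂ : k' + s' ≤ k + s) (h₃ : s' ≤ s) :
    outer k (s - s' + 1) (outer k' s' S) = outer k s S := by
  have hc : ((s - s' + 1 : ℕ) : ℝ) = s - s' + 1 := by
    rw [Nat.cast_add, Nat.cast_sub (by omega), Nat.cast_one]
  funext i
  rcases le_or_gt i k with hi | hi
  · rw [outer_of_le _ hi, outer_of_le _ hi, outer_of_le _ (by omega)]
  · rw [outer_of_gt _ hi, outer_of_gt _ hi, outer_of_gt _ (by omega), hc,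
      show i + (s - s' + 1) - 1 + s' - 1 = i + s - 1 by omega]
    ring

lemma outer_outer_of_disjoint (h : k + s ≤ k') (hs : 0 < s) (hs' : 0 < s') :
    outer k s (outer k' s' S) = outer (k' - s + 1) s' (outer k s S) := by
  funext i
  rcases le_or_gt i k with hi | hi
  · rw [outer_of_le _ hi, outer_of_le _ (by omega), outer_of_le _ (by omega), outer_of_le _ hi]
  rcases le_or_gt i (k' - s + 1) with hi' | hi'
  · rw [outer_of_gt _ hi, outer_of_le _ hi', outer_of_le _ (by omega), outer_of_gt _ hi]
  · rw [outer_of_gt _ hi, outer_of_gt _ hi', outer_of_gt _ (by omega), outer_of_gt _ (by omega),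
      show i + s - 1 + s' - 1 = i + s' - 1 + s - 1 by omega]
    ring

lemma inner_outer_right (h : k + s ≤ k') (hs : 0 < s) :
    inner (k' - s + 1) s' (outer k s S) = inner k' s' S := by
  funext j
  rcases lt_or_ge j s' with hj | hj
  · rw [inner_of_lt _ hj, inner_of_lt _ hj, outer_of_gt _ (by omega), outer_of_gt _ (by omega),
      show k' - s + 1 + j + s - 1 = k' + j by omega, show k' - s + 1 + s - 1 = k' by omega]
    ring
  · rw [inner_of_ge _ hj, inner_of_ge _ hj]

lemma inner_outer_left (h : k + s ≤ k') : inner k s (outer k' s' S) = inner k s S := by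
  funext j
  rcases lt_or_ge j s with hj | hj
  · rw [inner_of_lt _ hj, inner_of_lt _ hj, outer_of_le _ (by omega), outer_of_le _ (by omega)]
  · rw [inner_of_ge _ hj, inner_of_ge _ hj]

end identities

/-! ### The boundary and the centre -/

lemma baryS_of_lt {n i : ℕ} (h₀ : 0 < i) (h : i < n) : baryS n i = ((i : ℝ) - 1) / 2 := by
  rw [baryS, if_neg h₀.ne', if_pos h]

lemma baryS_of_ge {n i : ℕ} (h₀ : 0 < n) (h : n ≤ i) : baryS n i = n - 1 := by
  rw [baryS, if_neg (by omega), if_neg h.not_gt]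

lemma baryS_zero (n : ℕ) : baryS n 0 = 0 := if_pos rfl

lemma inPoly_baryS {n : ℕ} (hn : 2 ≤ n) : InPoly n (baryS n) := by
  have hn' : (2 : ℝ) ≤ n := by exact_mod_cast hn
  refine ⟨baryS_zero n, ?_, monotone_nat_of_le_succ fun i ↦ ?_, fun i ↦ ?_,
    fun i hi ↦ baryS_of_ge (by omega) hi⟩
  · rw [baryS_of_lt one_pos (by omega)]; simp
  · rcases Nat.eq_zero_or_pos i with rfl | hi
    · rw [baryS_zero, zero_add, baryS_of_lt one_pos (by omega)]; simp
    rcases lt_trichotomy (i + 1) n with h | h | h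
    · rw [baryS_of_lt hi (by omega), baryS_of_lt (by omega) h]
      push_cast; linarith
    · rw [baryS_of_lt hi (by omega), baryS_of_ge (by omega) h.ge, ← h]
      have : (1 : ℝ) ≤ i := by exact_mod_cast hi
      push_cast; linarith
    · rw [baryS_of_ge (by omega) (by omega), baryS_of_ge (by omega) (by omega)]
  · rcases lt_or_ge (i + 1) n with h | h
    · rw [baryS_of_lt (by omega) h]
      have : (0 : ℝ) ≤ i := i.cast_nonneg
      push_cast; linarith
    · rw [baryS_of_ge (by omega) h]
      have : (n : ℝ) ≤ i + 1 := by exact_mod_cast h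
      linarith

/-- A point of the polytope lies on the boundary if one of the defining inequalities is an
equality there. -/
def OnBoundary (n : ℕ) (S : ℕ → ℝ) : Prop :=
  ∃ i, 1 ≤ i ∧ i + 1 < n ∧ (S (i + 1) = S i ∨ S (i + 1) = i)

lemma OnFace.onBoundary {n k s : ℕ} {S : ℕ → ℝ} (h : OnFace n k s S) (hS : InPoly n S) :
    OnBoundary n S := by
  have := h.le_n
  have := h.two_le
  have := h.lt_n
  rcases Nat.eq_zero_or_pos k with rfl | hk
  · refine ⟨s - 1, by omega, by omega, .inr ?_⟩
    have h₁ := h.top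
    have h₂ := hS.le (s - 1)
    rw [hS.zero, zero_add] at h₁
    rw [show s - 1 + 1 = s by omega, Nat.cast_sub (by omega)] at *
    push_cast at *
    linarith
  · exact ⟨k, hk, by omega, .inl h.base⟩

/-- The faces cover the boundary. -/
lemma OnBoundary.exists_onFace {n : ℕ} {S : ℕ → ℝ} (h : OnBoundary n S) (hS : InPoly n S) :
    ∃ k s, OnFace n k s S := by
  obtain ⟨i, hi, hin, h | h⟩ := h
  -- The interval from `i` up to `n` meets the lower bound, since `S n = n - 1` and `S i ≤ i - 1`.
  -- The shortest interval from `i` that meets it is a face: minimality yields the upper bounds for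
  -- shorter intervals.
  · have hlast : 2 ≤ n - i ∧ ((n - i : ℕ) : ℝ) - 1 ≤ S (i + (n - i)) - S i := by
      refine ⟨by omega, ?_⟩
      have := hS.le (i - 1)
      rw [show i - 1 + 1 = i by omega, Nat.cast_sub hi] at this
      rw [show i + (n - i) = n by omega, hS.top n le_rfl, Nat.cast_sub (by omega)]
      push_cast at this
      linarith
    have hex : ∃ s : ℕ, 2 ≤ s ∧ (s : ℝ) - 1 ≤ S (i + s) - S i := ⟨n - i, hlast⟩
    classical
    have hmin : Nat.find hex ≤ n - i := Nat.find_min' hex hlast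
    obtain ⟨h₂, h₃⟩ := Nat.find_spec hex
    refine ⟨i, Nat.find hex, by omega, h₂, by omega, h, fun j hj ↦ ?_, h₃⟩
    rcases Nat.eq_zero_or_pos j with rfl | hj₀
    · simp [h]
    · have := Nat.find_min hex hj
      simp only [not_and, not_le] at this
      have := this (by omega)
      push_cast at this
      linarith
  · refine ⟨0, i + 1, by omega, by omega, hin, ?_, fun j _ ↦ ?_, ?_⟩
    · rw [zero_add, hS.one, hS.zero]
    · rw [zero_add, hS.zero, sub_zero]; exact hS.le j
    · rw [zero_add, hS.zero, h]; push_cast; linarith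

/-- The point `(1 - c) T + c b_n` in partial sum coordinates. -/
noncomputable def joinS (n : ℕ) (c : ℝ) (T : ℕ → ℝ) (i : ℕ) : ℝ := (1 - c) * T i + c * baryS n i

lemma joinS_zero (n : ℕ) (T : ℕ → ℝ) : joinS n 0 T = T := by funext i; simp [joinS]

lemma joinS_one (n : ℕ) (T : ℕ → ℝ) : joinS n 1 T = baryS n := by funext i; simp [joinS]

lemma InPoly.join {n : ℕ} (hn : 2 ≤ n) {c : ℝ} (h₀ : 0 ≤ c) (h₁ : c ≤ 1) {T : ℕ → ℝ}
    (h : InPoly n T) : InPoly n (joinS n c T) := by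
  have hb := inPoly_baryS hn
  refine ⟨?_, ?_, fun i j hij ↦ ?_, fun i ↦ ?_, fun i hi ↦ ?_⟩
  · simp [joinS, h.zero, hb.zero]
  · simp [joinS, h.one, hb.one]
  · exact add_le_add (mul_le_mul_of_nonneg_left (h.mono hij) (by linarith))
      (mul_le_mul_of_nonneg_left (hb.mono hij) h₀)
  · have e₁ := mul_le_mul_of_nonneg_left (h.le i) (sub_nonneg.2 h₁)
    have e₂ := mul_le_mul_of_nonneg_left (hb.le i) h₀
    unfold joinS
    linarith
  · rw [joinS, h.top i hi, hb.top i hi]; ring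

/-- The join coordinate is determined by the point. -/
lemma joinS_coord_le {n : ℕ} {c c' : ℝ} {T T' : ℕ → ℝ} (hb : OnBoundary n T)
    (hT' : InPoly n T') (h₁ : c' ≤ 1) (h : joinS n c T = joinS n c' T') : c' ≤ c := by
  obtain ⟨i, hi, hin, hb⟩ := hb
  have e₁ := congrFun h i
  have e₂ := congrFun h (i + 1)
  have hi' : (1 : ℝ) ≤ i := by exact_mod_cast hi
  simp only [joinS, baryS_of_lt hi (show i < n by omega), baryS_of_lt (Nat.succ_pos i) hin] at e₁ e₂
  push_cast at e₂
  -- The inequality tight at `T` has slack proportional to `c` on the left-hand point, and slack at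
  -- least the same multiple of `c'` on the right-hand one.
  rcases hb with hb | hb
  · have := mul_le_mul_of_nonneg_left (hT'.mono (Nat.le_succ i)) (sub_nonneg.2 h₁)
    rw [hb] at e₂
    linarith
  · have := mul_le_mul_of_nonneg_left (hT'.le i) (sub_nonneg.2 h₁)
    rw [hb] at e₂
    nlinarith

lemma joinS_injective {n : ℕ} {c : ℝ} (h₁ : c < 1) {T T' : ℕ → ℝ}
    (h : joinS n c T = joinS n c T') : T = T' := by
  funext i
  have := congrFun h i
  simp only [joinS, add_left_inj] at this
  exact mul_left_cancel₀ (by linarith) this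

/-- Every point of the polytope is the centre or lies on a segment from the boundary to the
centre. -/
lemma InPoly.eq_baryS_or_exists_join {n : ℕ} (hn : 2 ≤ n) {S : ℕ → ℝ} (hS : InPoly n S) :
    S = baryS n ∨ ∃ c T, 0 ≤ c ∧ c < 1 ∧ InPoly n T ∧ OnBoundary n T ∧ S = joinS n c T := by
  -- `f i` is the smaller slack of the two inequalities at `i`, normalised so that both slacks equal
  -- `1` at the centre. A join `(1 - c) T + c b_n` has slack `(1 - c) · slack(T) + c`, so the
  -- minimum of `f` has to be the join coordinate.
  set f : ℕ → ℝ := fun i ↦ min (2 * (S (i + 1) - S i)) (2 - 2 * S (i + 1) / i) with hf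
  have hb := inPoly_baryS hn
  have hsmall (h : ∀ i, 1 ≤ i → i + 1 < n → 1 ≤ f i) : S = baryS n := by
    -- Slacks of at least `1` bound `S (i + 1)` above by `i / 2` and its increments below by `1/2`,
    -- which leaves only the centre.
    have key (i : ℕ) (hi : i + 1 < n) : S (i + 1) = (i : ℝ) / 2 := by
      induction i with
      | zero => simp [hS.one]
      | succ i ih =>
        have h₁ := (le_min_iff.1 (h (i + 1) (by omega) hi)).1
        have h₂ := (le_min_iff.1 (h (i + 1) (by omega) hi)).2
        have hi0 : (0 : ℝ) < ((i + 1 : ℕ) : ℝ) := by positivity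
        have h₃ : 2 * S (i + 1 + 1) / ((i + 1 : ℕ) : ℝ) ≤ 1 := by linarith
        rw [div_le_one hi0] at h₃
        have := ih (by omega)
        push_cast at *
        linarith
    funext i
    rcases Nat.eq_zero_or_pos i with rfl | hi
    · rw [hS.zero, baryS_zero]
    rcases lt_or_ge i n with h' | h'
    · rw [baryS_of_lt hi h']
      have := key (i - 1) (by omega)
      rw [show i - 1 + 1 = i by omega, Nat.cast_sub hi] at this
      rw [this]; simp
    · rw [hS.top i h', hb.top i h']
  by_cases hsm : ∀ i, 1 ≤ i → i + 1 < n → 1 ≤ f i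
  · exact .inl (hsmall hsm)
  right
  push Not at hsm
  obtain ⟨i₀, hi₀, hi₀n, hlt⟩ := hsm
  obtain ⟨i, hi, hmin⟩ := Finset.exists_min_image (Finset.Ico 1 (n - 1)) f
    ⟨i₀, Finset.mem_Ico.2 ⟨hi₀, by omega⟩⟩
  rw [Finset.mem_Ico] at hi
  set c := f i with hc
  have hc1 : c < 1 := (hmin i₀ (Finset.mem_Ico.2 ⟨hi₀, by omega⟩)).trans_lt hlt
  have hc0 : 0 ≤ c := by
    have hi0 : (0 : ℝ) < i := by exact_mod_cast hi.1
    refine le_min (by linarith [hS.mono (Nat.le_succ i)]) ?_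
    have : S (i + 1) / i ≤ 1 := (div_le_one hi0).2 (hS.le i)
    rw [mul_div_assoc]
    linarith
  have hd : 0 < 1 - c := by linarith
  have hstep (j : ℕ) (hj : 1 ≤ j) (hjn : j + 1 < n) :
      c / 2 ≤ S (j + 1) - S j ∧ S (j + 1) ≤ j - c * (j / 2) := by
    have h₁ := le_min_iff.1 (hmin j (Finset.mem_Ico.2 ⟨hj, by omega⟩))
    have hj0 : (0 : ℝ) < j := by exact_mod_cast hj
    refine ⟨by linarith [h₁.1], ?_⟩
    have h₂ : S (j + 1) / j ≤ 1 - c / 2 := by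
      have := h₁.2
      rw [mul_div_assoc] at this
      linarith
    rw [div_le_iff₀ hj0] at h₂
    linarith
  -- Solve `S = (1 - c) T + c b_n` for `T`; the inequality realising the minimal slack becomes an
  -- equality at `T`.
  set T : ℕ → ℝ := fun j ↦ (S j - c * baryS n j) / (1 - c) with hT
  refine ⟨c, T, hc0, hc1, ⟨?_, ?_, ?_, ?_, ?_⟩, ?_, ?_⟩
  · simp [hT, hS.zero, hb.zero]
  · simp [hT, hS.one, hb.one]
  · refine monotone_nat_of_le_succ fun j ↦ ?_
    simp only [hT]
    rw [div_le_div_iff_of_pos_right hd]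
    rcases Nat.eq_zero_or_pos j with rfl | hj
    · simp [hS.zero, hS.one, hb.zero, hb.one]
    rcases lt_trichotomy (j + 1) n with h | h | h
    · rw [baryS_of_lt hj (by omega), baryS_of_lt (by omega) h]
      have := (hstep j hj h).1
      push_cast
      linarith
    · rw [hS.top _ h.ge, hb.top _ h.ge, baryS_of_lt hj (by omega), ← h]
      have hj1 := hS.le (j - 1)
      rw [show j - 1 + 1 = j by omega, Nat.cast_sub hj] at hj1
      have hj' : (1 : ℝ) ≤ j := by exact_mod_cast hj
      rcases Nat.lt_or_eq_of_le hj with hj2 | rfl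
      · have := (hstep (j - 1) (by omega) (by omega)).2
        rw [show j - 1 + 1 = j by omega, Nat.cast_sub hj] at this
        push_cast at *
        nlinarith
      · push_cast at *
        rw [hS.one]
        linarith
    · rw [hS.top _ h.le, hb.top _ h.le, hS.top _ (by omega), hb.top _ (by omega)]
  · intro j
    simp only [hT]
    rw [div_le_iff₀ hd]
    rcases Nat.eq_zero_or_pos j with rfl | hj
    · simp [hS.one, hb.one]
    rcases lt_or_ge (j + 1) n with h | h
    · rw [baryS_of_lt (by omega) h]
      have := (hstep j hj h).2
      push_cast
      linarith
    · rw [hS.top _ h, hb.top _ h]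
      have : (n : ℝ) ≤ j + 1 := by exact_mod_cast h
      nlinarith
  · intro j hj
    simp only [hT]
    rw [hS.top _ hj, hb.top _ hj]
    field_simp
  · refine ⟨i, hi.1, by omega, ?_⟩
    have hi0 : (0 : ℝ) < i := by exact_mod_cast hi.1
    simp only [hT, baryS_of_lt hi.1 (show i < n by omega),
      baryS_of_lt (Nat.succ_pos i) (show i + 1 < n by omega)]
    push_cast
    rcases min_choice (2 * (S (i + 1) - S i)) (2 - 2 * S (i + 1) / i) with h | h
    · left
      have : c = 2 * (S (i + 1) - S i) := h
      rw [div_left_inj' hd.ne']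
      linarith
    · right
      have : c = 2 - 2 * S (i + 1) / i := h
      rw [div_eq_iff hd.ne', this]
      field_simp
      ring
  · funext j
    simp only [joinS, hT]
    field_simp
    ring

/-! ### The reparametrisation attached to a point of the associahedron -/

/-- `HasReparam n S φ` says that `φ` is obtained, along a presentation of the point `S` of the
associahedron as a centre or as a join of a point on a face with the centre, by the corresponding
operations on reparametrisations. -/
inductive HasReparam : ℕ → (ℕ → ℝ) → (ℝ → ℝ) → Prop
  | apex {n : ℕ} (hn : 2 ≤ n) : HasReparam n (baryS n) (apexReparam n)
  | join {n r s k : ℕ} {T : ℕ → ℝ} {c : ℝ} {φ ψ : ℝ → ℝ} (hn : r + s = n + 1)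
      (hT : InPoly n T) (hf : OnFace n k s T) (h₀ : 0 ≤ c) (h₁ : c < 1)
      (hφ : HasReparam r (outer k s T) φ) (hψ : HasReparam s (inner k s T) ψ) :
      HasReparam n (joinS n c T) (joinReparam n c (ins k ψ ∘ φ))

namespace HasReparam

/-- A point on a face is its own join with `c = 0`, so faces need no constructor. The bound `c < 1`
in `join` prevents a second presentation of the centre. -/
lemma face {n r s k : ℕ} {T : ℕ → ℝ} {φ ψ : ℝ → ℝ} (hn : r + s = n + 1)
    (hT : InPoly n T) (hf : OnFace n k s T)
    (hφ : HasReparam r (outer k s T) φ) (hψ : HasReparam s (inner k s T) ψ) :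
    HasReparam n T (ins k ψ ∘ φ) := by
  have := join hn hT hf le_rfl zero_lt_one hφ hψ
  rwa [joinS_zero, joinReparam_zero] at this

lemma inPoly {n : ℕ} {S : ℕ → ℝ} {φ : ℝ → ℝ} (h : HasReparam n S φ) : InPoly n S := by
  cases h with
  | apex hn => exact inPoly_baryS hn
  | join hn hT hf h₀ h₁ _ _ =>
    have := hf.two_le
    have := hf.lt_n
    exact hT.join (by omega) h₀ h₁.le

lemma isReparam {n : ℕ} {S : ℕ → ℝ} {φ : ℝ → ℝ} (h : HasReparam n S φ) : IsReparam n φ := by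
  induction h with
  | apex => exact .apex _
  | join hn hT hf h₀ h₁ _ _ ihφ ihψ =>
    have := hf.le_n
    exact (ihφ.ins_comp ihψ hn (by omega)).join _

/-- Follow the ray from the centre to the boundary and factor there; both factors have smaller
index. Uniqueness uses this to obtain a reparametrisation of the third factor of a point on two
faces. -/
lemma exists_of_inPoly {n : ℕ} (hn : 2 ≤ n) {S : ℕ → ℝ} (hS : InPoly n S) :
    ∃ φ, HasReparam n S φ := by
  induction n using Nat.strong_induction_on generalizing S with
  | _ n ih =>
    rcases hS.eq_baryS_or_exists_join hn with rfl | ⟨c, T, h₀, h₁, hT, hb, rfl⟩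
    · exact ⟨_, apex hn⟩
    · obtain ⟨k, s, hf⟩ := hb.exists_onFace hT
      have h₂ := hf.two_le
      have h₃ := hf.lt_n
      have hr : n + 1 - s + s = n + 1 := by omega
      obtain ⟨φ, hφ⟩ := ih (n + 1 - s) (by omega) (by omega) (hf.outer_mem hT hr)
      obtain ⟨ψ, hψ⟩ := ih s h₃ h₂ (hf.inner_mem hT)
      exact ⟨_, join hr hT hf h₀ h₁ hφ hψ⟩

/-! ### Independence of the chosen face. -/

section compat

variable {n r s k r' s' k' : ℕ} {T : ℕ → ℝ} {φ ψ φ' ψ' : ℝ → ℝ}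

/-- Let `χ` belong to the middle factor, which is both the outer part of the inner factor and the
inner part of the outer one. By induction `ψ = ins (k' - k) ψ' ∘ χ` and `φ' = ins k χ ∘ φ`, so both
sides equal `ins k' ψ' ∘ ins k χ ∘ φ`. -/
lemma nested_compat
    (ih : ∀ m < n, ∀ S φ φ', HasReparam m S φ → HasReparam m S φ' → φ = φ')
    (hT : InPoly n T) (hn : r + s = n + 1) (hf : OnFace n k s T)
    (hφ : HasReparam r (outer k s T) φ) (hψ : HasReparam s (inner k s T) ψ)
    (hn' : r' + s' = n + 1) (hf' : OnFace n k' s' T)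
    (hφ' : HasReparam r' (outer k' s' T) φ') (hψ' : HasReparam s' (inner k' s' T) ψ')
    (h₁ : k ≤ k') (h₂ : k' + s' ≤ k + s) (h₃ : s' < s) :
    ins k ψ ∘ φ = ins k' ψ' ∘ φ' := by
  have hs := hf.lt_n
  have hs' := hf'.two_le
  have hi := hf.nested_inner hf' h₁ h₂ h₃
  have ho := hf.nested_outer hf' h₁ h₂ h₃ hn'
  have hin : s - s' + 1 + s' = s + 1 := by omega
  obtain ⟨χ, hχ⟩ := exists_of_inPoly (by omega) (hi.outer_mem (hf.inner_mem hT) hin)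
  have e₁ : ψ = ins (k' - k) ψ' ∘ χ :=
    ih s hs _ _ _ hψ (face hin (hf.inner_mem hT) hi hχ (by rwa [inner_inner T h₁ h₂]))
  rw [outer_inner T h₁ h₂ (by omega)] at hχ
  have e₂ : φ' = ins k χ ∘ φ :=
    ih r' (by omega) _ _ _ hφ' (face (r := r) (by omega) (hf'.outer_mem hT hn') ho
      (by rwa [outer_outer_of_nested T h₁ h₂ h₃.le]) hχ)
  have := hi.le_n
  funext t
  rw [e₁, e₂, Function.comp, ins_ins_comp hχ.isReparam hψ'.isReparam (by omega),
    Nat.add_sub_cancel' h₁]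
  rfl

/-- Here `χ` belongs to the factor left after collapsing both intervals. Both sides insert `ψ` and
`ψ'` into `χ`, in opposite orders. -/
lemma disjoint_compat
    (ih : ∀ m < n, ∀ S φ φ', HasReparam m S φ → HasReparam m S φ' → φ = φ')
    (hT : InPoly n T) (hn : r + s = n + 1) (hf : OnFace n k s T)
    (hφ : HasReparam r (outer k s T) φ) (hψ : HasReparam s (inner k s T) ψ)
    (hn' : r' + s' = n + 1) (hf' : OnFace n k' s' T)
    (hφ' : HasReparam r' (outer k' s' T) φ') (hψ' : HasReparam s' (inner k' s' T) ψ')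
    (h : k + s ≤ k') : ins k ψ ∘ φ = ins k' ψ' ∘ φ' := by
  have hs := hf.two_le
  have hs' := hf'.two_le
  have hle := hf'.le_n
  have hr := hf.disjoint_right hf' h hn
  have hl := hf.disjoint_left hf' h hn'
  have hin : r - s' + 1 + s' = r + 1 := by omega
  obtain ⟨χ, hχ⟩ := exists_of_inPoly (by omega) (hr.outer_mem (hf.outer_mem hT hn) hin)
  have e₁ : φ = ins (k' - s + 1) ψ' ∘ χ :=
    ih r (by omega) _ _ _ hφ (face hin (hf.outer_mem hT hn) hr hχ
      (by rwa [inner_outer_right T h (by omega)]))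
  rw [← outer_outer_of_disjoint T h (by omega) (by omega)] at hχ
  have e₂ : φ' = ins k ψ ∘ χ :=
    ih r' (by omega) _ _ _ hφ' (face (by omega) (hf'.outer_mem hT hn') hl hχ
      (by rwa [inner_outer_left T h]))
  funext t
  rw [e₁, e₂, Function.comp, Function.comp, ins_ins_of_lt hψ.isReparam hψ'.isReparam (by omega)
    (by omega), show k' - s + 1 + s - 1 = k' by omega]
  rfl

lemma face_compat
    (ih : ∀ m < n, ∀ S φ φ', HasReparam m S φ → HasReparam m S φ' → φ = φ')
    (hT : InPoly n T) (hn : r + s = n + 1) (hf : OnFace n k s T)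
    (hφ : HasReparam r (outer k s T) φ) (hψ : HasReparam s (inner k s T) ψ)
    (hn' : r' + s' = n + 1) (hf' : OnFace n k' s' T)
    (hφ' : HasReparam r' (outer k' s' T) φ') (hψ' : HasReparam s' (inner k' s' T) ψ') :
    ins k ψ ∘ φ = ins k' ψ' ∘ φ' := by
  have hs := hf.two_le
  have hsn := hf.lt_n
  by_cases h₁ : k + s ≤ k'
  · exact disjoint_compat ih hT hn hf hφ hψ hn' hf' hφ' hψ' h₁
  by_cases h₂ : k' + s' ≤ k
  · exact (disjoint_compat ih hT hn' hf' hφ' hψ' hn hf hφ hψ h₂).symm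
  by_cases h₃ : k = k' ∧ s = s'
  · obtain ⟨rfl, rfl⟩ := h₃
    obtain rfl : r = r' := by omega
    rw [ih r (by omega) _ _ _ hφ hφ', ih s hsn _ _ _ hψ hψ']
  by_cases h₄ : k ≤ k' ∧ k' + s' ≤ k + s
  · exact nested_compat ih hT hn hf hφ hψ hn' hf' hφ' hψ' h₄.1 h₄.2 (by omega)
  by_cases h₅ : k' ≤ k ∧ k + s ≤ k' + s'
  · exact (nested_compat ih hT hn' hf' hφ' hψ' hn hf hφ hψ h₅.1 h₅.2 (by omega)).symm
  rcases lt_or_ge k k' with h | h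
  · exact (hf.not_crossing hf' h (by omega) (by omega)).elim
  · exact (hf'.not_crossing hf (by omega) (by omega) (by omega)).elim

end compat

/-- A point of the associahedron has only one reparametrisation. -/
theorem unique {n : ℕ} {S : ℕ → ℝ} {φ φ' : ℝ → ℝ} (h : HasReparam n S φ)
    (h' : HasReparam n S φ') : φ = φ' := by
  induction n using Nat.strong_induction_on generalizing S φ φ' with
  | _ n ih =>
    have ih' : ∀ m < n, ∀ S φ φ', HasReparam m S φ → HasReparam m S φ' → φ = φ' :=
      fun m hm S φ φ' h h' ↦ ih m hm h h'
    -- The centre has join coordinate `1`, so it is not a join with `c < 1`.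
    have key {s k : ℕ} {T : ℕ → ℝ} {c : ℝ} (hT : InPoly n T) (hf : OnFace n k s T)
        (h₁ : c < 1) (e : baryS n = joinS n c T) : False := by
      have : 1 ≤ c := joinS_coord_le (hf.onBoundary hT) hT le_rfl
        (e.symm.trans (joinS_one n T).symm)
      linarith
    generalize hS : S = S' at h'
    cases h with
    | apex hn =>
      cases h' with
      | apex => rfl
      | join _ hT hf _ h₁ _ _ => exact (key hT hf h₁ hS).elim
    | @join _ r s k T c φ ψ hn hT hf h₀ h₁ hφ hψ =>
      cases h' with
      | apex => exact (key hT hf h₁ hS.symm).elim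
      | @join _ r' s' k' T' c' φ' ψ' hn' hT' hf' h₀' h₁' hφ' hψ' =>
        obtain rfl : c = c' := le_antisymm
          (joinS_coord_le (hf'.onBoundary hT') hT h₁.le hS.symm)
          (joinS_coord_le (hf.onBoundary hT) hT' h₁'.le hS)
        obtain rfl := joinS_injective h₁ hS
        rw [face_compat ih' hT hn hf hφ hψ hn' hf' hφ' hψ']

end HasReparam

/-! ### Partial sums of points of `ℝ^n` -/

/-- The partial sums of a vector. -/
def psum {n : ℕ} (t : Fin n → ℝ) (i : ℕ) : ℝ :=
  ∑ j ∈ Finset.range i, if h : j < n then t ⟨j, h⟩ else 0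

section psum

variable {n : ℕ} (t : Fin n → ℝ)

lemma psum_zero : psum t 0 = 0 := by simp [psum]

lemma psum_succ {i : ℕ} (h : i < n) : psum t (i + 1) = psum t i + t ⟨i, h⟩ := by
  rw [psum, Finset.sum_range_succ, dif_pos h]; rfl

lemma psum_of_ge {i : ℕ} (h : n ≤ i) : psum t i = psum t n := by
  induction i, h using Nat.le_induction with
  | base => rfl
  | succ m hm ih => rw [← ih, psum, Finset.sum_range_succ, dif_neg (by omega), add_zero]; rfl

end psum

lemma psum_bary {n : ℕ} (hn : 2 ≤ n) : psum (bary n) = baryS n := by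
  have key (i : ℕ) (hi : i ≤ n) : psum (bary n) i = baryS n i := by
    induction i with
    | zero => rw [psum_zero, baryS_zero]
    | succ i ih =>
      rw [psum_succ _ (by omega), ih (by omega)]
      rcases Nat.eq_zero_or_pos i with rfl | h₀
      · rw [baryS_zero, (inPoly_baryS hn).one]; simp [bary]
      rcases hi.lt_or_eq with h | h
      · rw [baryS_of_lt h₀ (by omega), baryS_of_lt (by omega) h, bary, if_neg h₀.ne',
          if_neg h.ne]
        push_cast; ring
      · rw [baryS_of_lt h₀ (by omega), baryS_of_ge (by omega) h.ge, bary, if_neg h₀.ne', if_pos h,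
          ← h]
        push_cast; ring
  funext i
  rcases le_total i n with h | h
  · exact key i h
  · rw [psum_of_ge _ h, key n le_rfl, baryS_of_ge (by omega) le_rfl, baryS_of_ge (by omega) h]

lemma psum_join {n : ℕ} (hn : 2 ≤ n) (c : ℝ) (t : Fin n → ℝ) :
    psum ((1 - c) • t + c • bary n) = joinS n c (psum t) := by
  funext i
  rw [joinS, ← psum_bary hn, psum, psum, psum, Finset.mul_sum, Finset.mul_sum,
    ← Finset.sum_add_distrib]
  refine Finset.sum_congr rfl fun j _ ↦ ?_
  split_ifs <;> simp

/-! ### Face operators in partial sum coordinates. -/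

section face

variable {n r s : ℕ} (hn : r + s = n + 1) (k : Fin r) (t : Fin r → ℝ) (u : Fin s → ℝ)

lemma psum_faceMap_of_le {i : ℕ} (h : i ≤ k.1) (hs : 1 ≤ s) :
    psum (faceMap hn k t u) i = psum t i := by
  induction i with
  | zero => rw [psum_zero, psum_zero]
  | succ i ih =>
    have := k.2
    rw [psum_succ _ (by omega), psum_succ _ (by omega), ih (by omega), faceMap,
      dif_pos (show i < k.1 from h)]

lemma psum_faceMap_of_lt {j : ℕ} (h : j < s) :
    psum (faceMap hn k t u) (k.1 + j) = psum t k.1 + psum u j := by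
  have := k.2
  induction j with
  | zero => rw [psum_zero, add_zero, add_zero, psum_faceMap_of_le hn k t u le_rfl (by omega)]
  | succ j ih =>
    rw [← add_assoc, psum_succ _ (by omega), psum_succ _ (by omega), ih (by omega), faceMap,
      dif_neg (by simp), dif_pos (by simp only []; omega), if_neg (by simp only []; omega)]
    simp [add_assoc]

lemma psum_faceMap_of_gt_of_le {i : ℕ} (h : k.1 < i) (hi : i ≤ r) (hs : 1 ≤ s) :
    psum (faceMap hn k t u) (i + s - 1) = psum t i + psum u s := by
  have := k.2
  induction i, h using Nat.le_induction with
  | base =>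
    rw [show k.1.succ + s - 1 = k.1 + (s - 1) + 1 by omega, psum_succ _ (by omega),
      psum_faceMap_of_lt hn k t u (by omega), psum_succ t k.2]
    have e := psum_succ u (show s - 1 < s by omega)
    rw [Nat.sub_add_cancel hs] at e
    rw [e, faceMap, dif_neg (by simp), dif_pos (by simp only []; omega),
      if_pos (by simp only []; omega)]
    simp only [Nat.add_sub_cancel_left, Fin.eta]
    ring
  | succ i hi' ih =>
    have hi'' : k.1 < i := hi'
    rw [show i + 1 + s - 1 = i + s - 1 + 1 by omega, psum_succ _ (by omega), ih (by omega),
      psum_succ t (by omega), faceMap, dif_neg (by simp only []; omega),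
      dif_neg (by simp only []; omega)]
    simp only [show i + s - 1 + 1 - s = i by omega]
    ring

lemma psum_faceMap_of_gt {i : ℕ} (h : k.1 < i) (hs : 1 ≤ s) :
    psum (faceMap hn k t u) (i + s - 1) = psum t i + psum u s := by
  rcases le_total i r with hi | hi
  · exact psum_faceMap_of_gt_of_le hn k t u h hi hs
  · have := psum_faceMap_of_gt_of_le hn k t u k.2 le_rfl hs
    rw [show r + s - 1 = n by omega] at this
    rw [psum_of_ge _ (by omega), this, psum_of_ge t hi]

variable {t u}

/-- The coordinates of `u` add up to `s - 1`, exactly the shift that `outer` subtracts beyond the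
interval. -/
lemma outer_psum_faceMap (hu : InPoly s (psum u)) (hs : 1 ≤ s) :
    outer k.1 s (psum (faceMap hn k t u)) = psum t := by
  funext i
  rcases le_or_gt i k.1 with h | h
  · rw [outer_of_le _ h, psum_faceMap_of_le hn k t u h hs]
  · rw [outer_of_gt _ h, psum_faceMap_of_gt hn k t u h hs, hu.top s le_rfl]; ring

lemma inner_psum_faceMap (hu : InPoly s (psum u)) (hs : 1 ≤ s) :
    inner k.1 s (psum (faceMap hn k t u)) = psum u := by
  funext j
  rcases lt_or_ge j s with h | h
  · rw [inner_of_lt _ h, psum_faceMap_of_lt hn k t u h, psum_faceMap_of_le hn k t u le_rfl hs]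
    ring
  · rw [inner_of_ge _ h, hu.top j h]

lemma onFace_psum_faceMap (ht : InPoly r (psum t)) (hu : InPoly s (psum u)) (hr : 2 ≤ r)
    (hs : 2 ≤ s) : OnFace n k.1 s (psum (faceMap hn k t u)) := by
  have := k.2
  have e := psum_faceMap_of_le hn k t u le_rfl (by omega)
  refine ⟨by omega, hs, by omega, ?_, fun j hj ↦ ?_, ?_⟩
  · rw [psum_faceMap_of_lt hn k t u (by omega), e, hu.one, add_zero]
  · rw [psum_faceMap_of_lt hn k t u hj, e]
    linarith [hu.le j]
  · rw [show k.1 + s = k.1 + 1 + s - 1 by omega,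
      psum_faceMap_of_gt hn k t u (Nat.lt_succ_self _) (by omega), e, hu.top s le_rfl]
    linarith [ht.mono (Nat.le_succ k.1)]

lemma inPoly_psum_faceMap (ht : InPoly r (psum t)) (hu : InPoly s (psum u)) (hs : 2 ≤ s) :
    InPoly n (psum (faceMap hn k t u)) := by
  have hk := k.2
  have hn' : (r : ℝ) + s = n + 1 := by exact_mod_cast hn
  refine ⟨psum_zero _, ?_, monotone_nat_of_le_succ fun i ↦ ?_, fun i ↦ ?_, fun i hi ↦ ?_⟩
  · rcases Nat.eq_zero_or_pos k.1 with h | h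
    · have := psum_faceMap_of_lt hn k t u (show 1 < s by omega)
      rw [h, zero_add] at this
      rw [this, ht.zero, hu.one, add_zero]
    · rw [psum_faceMap_of_le hn k t u h (by omega), ht.one]
  · rcases lt_or_ge i k.1 with h | h
    · rw [psum_faceMap_of_le hn k t u h.le (by omega), psum_faceMap_of_le hn k t u h (by omega)]
      exact ht.mono (Nat.le_succ i)
    obtain ⟨j, rfl⟩ := Nat.exists_eq_add_of_le h
    rcases lt_trichotomy (j + 1) s with h' | h' | h'
    · rw [psum_faceMap_of_lt hn k t u (by omega), add_assoc, psum_faceMap_of_lt hn k t u h']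
      linarith [hu.mono (Nat.le_succ j)]
    · rw [psum_faceMap_of_lt hn k t u (by omega), show k.1 + j + 1 = k.1 + 1 + s - 1 by omega,
        psum_faceMap_of_gt hn k t u (Nat.lt_succ_self _) (by omega)]
      linarith [hu.mono (show j ≤ s by omega), ht.mono (Nat.le_succ k.1)]
    · obtain ⟨m', hm'⟩ : ∃ m', k.1 + j = m' + s - 1 := ⟨k.1 + j + 1 - s, by omega⟩
      rw [show k.1 + j + 1 = m' + 1 + s - 1 by omega, hm',
        psum_faceMap_of_gt hn k t u (by omega) (by omega),
        psum_faceMap_of_gt hn k t u (by omega) (by omega)]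
      linarith [ht.mono (Nat.le_succ m')]
  · rcases le_or_gt (i + 1) k.1 with h | h
    · rw [psum_faceMap_of_le hn k t u h (by omega)]
      exact ht.le i
    rcases lt_or_ge (i + 1) (k.1 + s) with h' | h'
    · obtain ⟨j, hj⟩ := Nat.exists_eq_add_of_le h.le
      rw [hj, psum_faceMap_of_lt hn k t u (by omega)]
      obtain ⟨m, rfl⟩ : ∃ m, j = m + 1 := ⟨j - 1, by omega⟩
      have e : (i : ℝ) = k.1 + m := by exact_mod_cast (by omega : i = k.1 + m)
      have : psum t k.1 ≤ k.1 := (ht.mono (Nat.le_succ _)).trans (ht.le _)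
      linarith [hu.le m]
    · obtain ⟨m, hm⟩ : ∃ m, i + 1 = m + 1 + s - 1 := ⟨i + 1 - s, by omega⟩
      rw [hm, psum_faceMap_of_gt hn k t u (by omega) (by omega), hu.top s le_rfl]
      have e : (i : ℝ) + 1 = m + s := by exact_mod_cast (by omega : i + 1 = m + s)
      linarith [ht.le m]
  · obtain ⟨m, rfl⟩ : ∃ m, i = m + s - 1 := ⟨i + 1 - s, by omega⟩
    rw [psum_faceMap_of_gt hn k t u (by omega) (by omega), hu.top s le_rfl, ht.top m (by omega)]
    linarith

end face

lemma HasReparam.faceMap {n r s : ℕ} (hn : r + s = n + 1) (hr : 2 ≤ r) (hs : 2 ≤ s) (k : Fin r)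
    {t : Fin r → ℝ} {u : Fin s → ℝ} {φ ψ : ℝ → ℝ} (hφ : HasReparam r (psum t) φ)
    (hψ : HasReparam s (psum u) ψ) :
    HasReparam n (psum (faceMap hn k t u)) (ins k ψ ∘ φ) := by
  refine .face hn (inPoly_psum_faceMap hn k hφ.inPoly hψ.inPoly hs)
    (onFace_psum_faceMap hn k hφ.inPoly hψ.inPoly hr hs) ?_ ?_
  · rwa [outer_psum_faceMap hn k hψ.inPoly (by omega)]
  · rwa [inner_psum_faceMap hn k hψ.inPoly (by omega)]

lemma HasReparam.coneFace {n r s : ℕ} (hn : r + s = n + 1) (hr : 2 ≤ r) (hs : 2 ≤ s) (k : Fin r)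
    {t : Fin r → ℝ} {u : Fin s → ℝ} {φ ψ : ℝ → ℝ} (hφ : HasReparam r (psum t) φ)
    (hψ : HasReparam s (psum u) ψ) {c : ℝ} (h₀ : 0 ≤ c) (h₁ : c ≤ 1) :
    HasReparam n (psum ((1 - c) • SmoothAInfty.faceMap hn k t u + c • bary n))
      (joinReparam n c (ins k ψ ∘ φ)) := by
  rw [psum_join (by omega)]
  rcases h₁.lt_or_eq with h | rfl
  · refine .join hn (inPoly_psum_faceMap hn k hφ.inPoly hψ.inPoly hs)
      (onFace_psum_faceMap hn k hφ.inPoly hψ.inPoly hr hs) h₀ h ?_ ?_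
    · rwa [outer_psum_faceMap hn k hψ.inPoly (by omega)]
    · rwa [inner_psum_faceMap hn k hψ.inPoly (by omega)]
  · rw [joinS_one, joinReparam_one]
    exact .apex (by omega)

/-- The reparametrisations along a cell form a smooth family. -/
lemma IsCell.exists_family {n q : ℕ} {π : EuclideanSpace ℝ (Fin q) → (Fin n → ℝ)}
    (h : IsCell n q π) : ∃ f : EuclideanSpace ℝ (Fin q) → ℝ → ℝ,
      (∀ x, HasReparam n (psum (π x)) (f x)) ∧ ∀ x t, SlotSmoothAt n f x t := by
  -- The coordinate selections `a` and `b` are arbitrary, so that one statement serves both product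
  -- cells and the bases of joins.
  have hface {n r s q₁ q₂ q : ℕ} (hn : r + s = n + 1) (hs : 2 ≤ s) (k : Fin r)
      {f₁ : EuclideanSpace ℝ (Fin q₁) → ℝ → ℝ} {f₂ : EuclideanSpace ℝ (Fin q₂) → ℝ → ℝ}
      (h₁ : ∀ x t, SlotSmoothAt r f₁ x t) (h₂ : ∀ x t, SlotSmoothAt s f₂ x t)
      (hr : ∀ x, IsReparam s (f₂ x)) (a : Fin q₁ → Fin q) (b : Fin q₂ → Fin q)
      (x : EuclideanSpace ℝ (Fin q)) (t : ℝ) :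
      SlotSmoothAt n (fun x : EuclideanSpace ℝ (Fin q) ↦ ins k 
        (f₂ (WithLp.toLp 2 fun i ↦ x (b i))) ∘ f₁ (WithLp.toLp 2 fun i ↦ x (a i))) x t :=
    SlotSmoothAt.ins_comp
      (h₁ := fun x : EuclideanSpace ℝ (Fin q) ↦ f₁ (WithLp.toLp 2 fun i ↦ x (a i)))
      (h₂ := fun x : EuclideanSpace ℝ (Fin q) ↦ f₂ (WithLp.toLp 2 fun i ↦ x (b i)))
      ((h₁ _ t).comp (f := fun x : EuclideanSpace ℝ (Fin q) ↦ WithLp.toLp 2 fun i ↦ x (a i))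
        (u := fun _ t ↦ t) (by fun_prop) contDiffAt_snd)
      (fun u ↦ (h₂ _ u).comp
        (f := fun x : EuclideanSpace ℝ (Fin q) ↦ WithLp.toLp 2 fun i ↦ x (b i))
        (u := fun _ t ↦ t) (by fun_prop) contDiffAt_snd)
      (fun _ ↦ hr _) (by omega) hn k.2
  induction h with
  | apex hn =>
    refine ⟨fun _ ↦ apexReparam _, fun x ↦ ?_, fun x t ↦ slotSmoothAt_apex (by omega) x t⟩
    rw [psum_bary hn]
    exact .apex hn
  | face hn hr hs k _ _ ih₁ ih₂ =>
    obtain ⟨f₁, r₁, s₁⟩ := ih₁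
    obtain ⟨f₂, r₂, s₂⟩ := ih₂
    exact ⟨_, fun x ↦ HasReparam.faceMap hn hr hs k (r₁ _) (r₂ _),
      hface hn hs k s₁ s₂ (fun x ↦ (r₂ x).isReparam) _ _⟩
  | @cone n r s q₁ q₂ hn hr hs k _ _ _ _ ih₁ ih₂ =>
    obtain ⟨f₁, r₁, s₁⟩ := ih₁
    obtain ⟨f₂, r₂, s₂⟩ := ih₂
    refine ⟨fun x ↦ joinReparam n (x (Fin.last _))
      (ins k (f₂ (WithLp.toLp 2 fun j ↦ x (Fin.natAdd q₁ j).castSucc)) ∘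
        f₁ (WithLp.toLp 2 fun i ↦ x (Fin.castAdd q₂ i).castSucc)), fun x ↦ ?_, fun x t ↦ ?_⟩
    · beta_reduce
      rw [← joinReparam_clamp]
      exact HasReparam.coneFace hn hr hs k (r₁ _) (r₂ _) (le_max_left _ _)
        (max_le zero_le_one (min_le_left _ _))
    · exact (hface hn hs k s₁ s₂ (fun x ↦ (r₂ x).isReparam) _ _ x t).join (by omega)
        ((r₁ _).isReparam.ins_comp (r₂ _).isReparam hn k.2) (by fun_prop)

/-! ### Reparametrisations along plots of the associahedron -/

lemma IsCell.two_le {n q : ℕ} {π : EuclideanSpace ℝ (Fin q) → (Fin n → ℝ)} (h : IsCell n q π) :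
    2 ≤ n := by
  cases h <;> omega

namespace Associahedron

variable {n : ℕ}

lemma two_le (ρ : Associahedron n) : 2 ≤ n := by
  obtain ⟨_, _, h, _⟩ := ρ.mem_cell
  exact h.two_le

lemma pos (ρ : Associahedron n) : 0 < n := two_pos.trans_le ρ.two_le

lemma exists_hasReparam (ρ : Associahedron n) : ∃ φ, HasReparam n (psum ρ.val) φ := by
  obtain ⟨q, π, h, x, e⟩ := ρ.mem_cell
  obtain ⟨f, hf, -⟩ := h.exists_family
  exact ⟨f x, e ▸ hf x⟩

/-- The reparametrisation `[0, 1] → [0, n]` attached to a point of `|𝕂(n)|`. -/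
noncomputable def reparam (ρ : Associahedron n) : ℝ → ℝ := ρ.exists_hasReparam.choose

lemma hasReparam (ρ : Associahedron n) : HasReparam n (psum ρ.val) ρ.reparam :=
  ρ.exists_hasReparam.choose_spec

lemma isReparam (ρ : Associahedron n) : IsReparam n ρ.reparam := ρ.hasReparam.isReparam

lemma reparam_eq {ρ : Associahedron n} {φ : ℝ → ℝ} (h : HasReparam n (psum ρ.val) φ) :
    ρ.reparam = φ := ρ.hasReparam.unique h

lemma reparam_apex (hn : 2 ≤ n) : (apex n hn).reparam = apexReparam n :=
  reparam_eq (by rw [apex, psum_bary hn]; exact .apex hn)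

lemma reparam_face {r s : ℕ} (hn : r + s = n + 1) (hr : 2 ≤ r) (hs : 2 ≤ s) (k : Fin r)
    (ρ : Associahedron r) (σ : Associahedron s) :
    (face hn hr hs k ρ σ).reparam = ins k.1 σ.reparam ∘ ρ.reparam :=
  reparam_eq (ρ.hasReparam.faceMap hn hr hs k σ.hasReparam)

/-- The diffeology on `|𝕂(n)|` whose plots are the maps along which the reparametrisations form a
smooth family. -/
@[reducible]
noncomputable def reparamDiffeology (n : ℕ) : DiffeologicalSpace (Associahedron n) :=
  .ofCorePlotsOn {
    isPlotOn := fun {_ u} _ p ↦ ∀ x ∈ u, ∀ t, SlotSmoothAt n (fun x ↦ (p x).reparam) x t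
    isPlotOn_congr := by
      intro m u hu p q h
      have key {p q : EuclideanSpace ℝ (Fin m) → Associahedron n} (h : Set.EqOn p q u)
          (hp : ∀ x ∈ u, ∀ t, SlotSmoothAt n (fun x ↦ (p x).reparam) x t) (x) (hx : x ∈ u) (t) :
          SlotSmoothAt n (fun x ↦ (q x).reparam) x t := by
        refine (hp x hx t).congr ?_
        filter_upwards [continuousAt_fst.eventually (hu.mem_nhds hx)] with z hz
        rw [h hz]
      exact ⟨key h, key h.symm⟩
    -- Slot-smoothness in time at a single point is inherited from the family along a cell
    -- containing it.
    isPlot_const := by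
      intro m ρ x _ t
      obtain ⟨q, π, h, y, e⟩ := ρ.mem_cell
      obtain ⟨f, hf, hs⟩ := h.exists_family
      beta_reduce
      rw [reparam_eq (e ▸ hf y : HasReparam n (psum ρ.val) (f y))]
      exact (hs y t).comp (f := fun _ ↦ y) (u := fun _ t ↦ t) contDiffAt_const contDiffAt_snd
    isPlotOn_reparam := by
      intro m m' u v hu hv p f h hp hf x hx t
      exact (hp (f x) (h hx) t).comp (u := fun _ t ↦ t) (hf.contDiffAt (hv.mem_nhds hx))
        contDiffAt_snd
    locality := by
      intro m u hu p hp x hx t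
      obtain ⟨v, hv, hxv, h⟩ := hp x hx
      exact h x hxv t }

/-- The colimit diffeology is generated by the cell charts, so it is contained in every diffeology
having these charts as plots; `reparamDiffeology` is one by `exists_family` and uniqueness. -/
lemma slotSmoothAt_of_isPlot {m : ℕ} {p : EuclideanSpace ℝ (Fin m) → Associahedron n}
    (hp : IsPlot p) (x : EuclideanSpace ℝ (Fin m)) (t : ℝ) :
    SlotSmoothAt n (fun x ↦ (p x).reparam) x t := by
  have hle : instAssociahedron n ≤ reparamDiffeology n := by
    refine DiffeologicalSpace.generateFrom_le_iff.2 fun q π hπ ↦ ?_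
    obtain ⟨f, hf, hs⟩ := IsCell.exists_family hπ
    intro y _ t
    rw [show (fun x ↦ (π x).reparam) = f from funext fun x ↦ reparam_eq (hf x)]
    exact hs y t
  exact DiffeologicalSpace.le_iff'.1 hle m p hp x trivial t

end Associahedron

/-! ### Concatenation of paths -/

section Paths

variable {X : Type*} [DiffeologicalSpace X]

lemma PathSpace.apply_of_nonpos (u : PathSpace X) {t : ℝ} (h : t ≤ 0) :
    u.1.toFun t = u.1.toFun 0 := by
  rw [← u.2 t, clamp, max_eq_left ((min_le_right _ _).trans h)]

lemma PathSpace.apply_of_one_le (u : PathSpace X) {t : ℝ} (h : 1 ≤ t) :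
    u.1.toFun t = u.1.toFun 1 := by
  rw [← u.2 t, clamp, min_eq_left h, max_eq_right zero_le_one]

/-- The path `[0, n] → X` which on `[i, i + 1]` is the `i`-th path of the chain. -/
noncomputable def total {n : ℕ} (hn : 0 < n) (g : Chain (pathPrecategory X) n) (v : ℝ) : X :=
  -- The minimum assigns the end point `v = n` to the last slot.
  (g.1 ⟨min ⌊v⌋₊ (n - 1), by omega⟩).1.toFun (v - (min ⌊v⌋₊ (n - 1) : ℕ))

lemma total_eq {n : ℕ} (hn : 0 < n) (g : Chain (pathPrecategory X) n) {i : ℕ} (hi : i < n) {v : ℝ}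
    (hv : v ∈ Set.Icc (i : ℝ) (i + 1)) : total hn g v = (g.1 ⟨i, hi⟩).1.toFun (v - i) := by
  have key (j : ℕ) (hj : min ⌊v⌋₊ (n - 1) = j) (hjn : j < n) :
      total hn g v = (g.1 ⟨j, hjn⟩).1.toFun (v - j) := by
    subst hj; rfl
  have h₀ : (0 : ℝ) ≤ v := i.cast_nonneg.trans hv.1
  rcases hv.2.lt_or_eq with h | h
  · have : ⌊v⌋₊ = i := (Nat.floor_eq_iff h₀).2 ⟨hv.1, h⟩
    exact key i (by omega) hi
  -- At the right end of a slot the floor selects the next path; the chain condition makes the two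
  -- values agree.
  · have hf : ⌊v⌋₊ = i + 1 := by
      rw [h]; exact_mod_cast Nat.floor_natCast (R := ℝ) (i + 1)
    rcases Nat.lt_or_eq_of_le (Nat.succ_le_of_lt hi) with h' | h'
    · rw [key (i + 1) (by omega) h', h]
      have := g.2 i h'
      push_cast
      rw [sub_self, add_sub_cancel_left]
      exact this.symm
    · exact key i (by omega) hi

/-- Near each parameter only one path of the chain is used, and its evaluation is smooth by the
functional diffeology. Locality of plots does the rest. -/
lemma dSmooth_total {n m : ℕ} (hn : 0 < n)
    {g : EuclideanSpace ℝ (Fin m) → Chain (pathPrecategory X) n} (hg : IsPlot g)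
    {h : EuclideanSpace ℝ (Fin m) → ℝ → ℝ} (hh : ∀ x t, SlotSmoothAt n h x t) :
    DSmooth fun z : EuclideanSpace ℝ (Fin m) × ℝ ↦ total hn (g z.1) (h z.1 z.2) := by
  intro l q hq
  have hq₁ : ContDiff ℝ ∞ fun a ↦ (q a).1 := isPlot_iff_contDiff.1 hq.1
  have hq₂ : ContDiff ℝ ∞ fun a ↦ (q a).2 := isPlot_iff_contDiff.1 hq.2
  have hc : ContDiff ℝ ∞ fun a ↦ h (q a).1 (q a).2 := contDiff_iff_contDiffAt.2 fun a ↦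
    ContDiffAt.comp a (g := fun z : EuclideanSpace ℝ (Fin m) × ℝ ↦ h z.1 z.2)
      (hh (q a).1 (q a).2).1 (hq₁.prodMk hq₂).contDiffAt
  refine DiffeologicalSpace.locality fun a ↦ ?_
  obtain ⟨i, hi, hm⟩ := (hh (q a).1 (q a).2).2
  obtain ⟨u, hu, huo, hau⟩ := eventually_nhds_iff.1
    ((hq₁.prodMk hq₂).continuous.continuousAt.eventually hm)
  refine ⟨u, huo, hau, fun {l' f} hf hfc ↦ ?_⟩
  have e : (fun z : EuclideanSpace ℝ (Fin m) × ℝ ↦ total hn (g z.1) (h z.1 z.2)) ∘ q ∘ f =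
      fun b ↦ ((g (q (f b)).1).1 ⟨i, hi⟩).1.toFun (h (q (f b)).1 (q (f b)).2 - i) :=
    funext fun b ↦ total_eq hn _ hi (hu (f b) (hf b))
  rw [Function.comp_assoc, e]
  have hgi : DSmooth fun z : EuclideanSpace ℝ (Fin m) × ℝ ↦ ((g z.1).1 ⟨i, hi⟩).1.toFun z.2 :=
    hg ⟨i, hi⟩
  exact hgi l' (fun b ↦ ((q (f b)).1, h (q (f b)).1 (q (f b)).2 - i))
    ⟨(hq₁.comp hfc).isPlot, ((hc.comp hfc).sub contDiff_const).isPlot⟩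

/-- The concatenation of a chain of paths, parametrised according to a point of `|𝕂(n)|`. -/
noncomputable def concat {n : ℕ} (z : Associahedron n × Chain (pathPrecategory X) n) :
    PathSpace X :=
  ⟨⟨fun t ↦ total z.1.pos z.2 (z.1.reparam t), fun l q hq ↦
      -- A single path is treated as a family over the point `ℝ^0`.
      dSmooth_total (m := 0) z.1.pos (g := fun _ ↦ z.2) isPlot_const
        (h := fun _ ↦ z.1.reparam)
        (fun x t ↦ Associahedron.slotSmoothAt_of_isPlot (p := fun _ ↦ z.1) isPlot_const x t)
        l (fun a ↦ (0, q a)) ⟨isPlot_const, hq⟩⟩,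
    fun t ↦ congrArg (total z.1.pos z.2) (z.1.isReparam.clamp t)⟩

lemma concat_apply {n : ℕ} (hn : 0 < n) (ρ : Associahedron n)
    (g : Chain (pathPrecategory X) n) (t : ℝ) :
    (concat (ρ, g)).1.toFun t = total hn g (ρ.reparam t) := rfl

lemma dSmooth_concat (n : ℕ) : DSmooth (concat (X := X) (n := n)) := by
  intro m p hp
  exact dSmooth_total (p 0).1.pos hp.2 (Associahedron.slotSmoothAt_of_isPlot hp.1)

lemma concat_zero {n : ℕ} (hn : 0 < n) (ρ : Associahedron n) (g : Chain (pathPrecategory X) n) :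
    (concat (ρ, g)).1.toFun 0 = (g.1 ⟨0, hn⟩).1.toFun 0 := by
  rw [concat_apply hn, ρ.isReparam.of_nonpos 0 le_rfl, total_eq hn g hn (by simp)]
  simp

lemma concat_one {n : ℕ} (hn : 0 < n) (ρ : Associahedron n) (g : Chain (pathPrecategory X) n) :
    (concat (ρ, g)).1.toFun 1 = (g.1 ⟨n - 1, by omega⟩).1.toFun 1 := by
  have e : ((n - 1 : ℕ) : ℝ) = n - 1 := by rw [Nat.cast_pred hn]
  rw [concat_apply hn, ρ.isReparam.of_one_le 1 le_rfl,
    total_eq hn g (i := n - 1) (by omega) (by rw [e]; constructor <;> linarith), e]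
  congr 1
  ring

/-- This is the `A_∞` relation before reparametrising by `ρ`: slots before `k` are unchanged, slot
`k` runs through the inner concatenation by `ψ`, and later slots are shifted by `s - 1`. -/
lemma total_graft {n r s : ℕ} (hn : r + s = n + 1) (hs : 2 ≤ s) (k : Fin r)
    (g : Chain (pathPrecategory X) n) {ψ : ℝ → ℝ} (hψ : IsReparam s ψ) (m : PathSpace X)
    (hm : ∀ t, m.1.toFun t = total (by omega) (g.sub hn k) (ψ t)) (hsrc) (htgt) {v : ℝ}
    (hv : v ∈ Set.Icc (0 : ℝ) r) :
    total (by have := k.2; omega) g (ins k.1 ψ v) =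
      total (by have := k.2; omega) (g.graft hn hs k m hsrc htgt) v := by
  have hk := k.2
  obtain ⟨i, hi, hiv⟩ := exists_slot (by omega) hv
  rw [total_eq _ (g.graft hn hs k m hsrc htgt) hi hiv]
  rcases lt_trichotomy i k.1 with h | h | h
  · have h' : (i : ℝ) + 1 ≤ k.1 := by exact_mod_cast h
    rw [ins_of_le hψ (hiv.2.trans h'), total_eq _ g (by omega) hiv]
    simp only [Chain.graft, if_pos h]
  · subst h
    rw [ins_of_mem ψ hiv.1 hiv.2]
    obtain ⟨j, hj, hjv⟩ := exists_slot (by omega) (hψ.mem_Icc (v - k.1))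
    simp only [Chain.graft, lt_irrefl, if_false, if_true]
    rw [hm, total_eq _ _ hj hjv, total_eq _ g (i := k.1 + j) (by omega)
      (by push_cast; constructor <;> linarith [hjv.1, hjv.2])]
    push_cast
    rw [add_sub_add_left_eq_sub]
    rfl
  · have h' : (k.1 : ℝ) + 1 ≤ i := by exact_mod_cast h
    have e : ((i + s - 1 : ℕ) : ℝ) = i + (s - 1) := by
      rw [Nat.cast_sub (by omega)]; push_cast; ring
    rw [ins_of_ge hψ (h'.trans hiv.1), total_eq _ g (i := i + s - 1) (by omega)
      (by rw [e]; constructor <;> linarith [hiv.1, hiv.2]), e, add_sub_add_right_eq_sub]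
    simp only [Chain.graft, if_neg h.not_gt, if_neg h.ne']

/-- The smooth `A_∞`-form on the path precategory. -/
noncomputable def pathForm (X : Type*) [DiffeologicalSpace X] :
    AInftyForm (pathPrecategory X) where
  M _ := concat
  smooth n _ := dSmooth_concat n
  src_M _ hn ρ g := concat_zero (by omega) ρ g
  tgt_M _ hn ρ g := concat_one (by omega) ρ g
  assoc {n r s} hn hr hs k ρ σ g := by
    refine Subtype.ext (SmoothMap.ext (funext fun t ↦ ?_))
    rw [concat_apply (by omega), concat_apply (by omega), Associahedron.reparam_face]
    exact total_graft hn hs k g σ.isReparam _ (fun _ ↦ rfl) _ _ (ρ.isReparam.mem_Icc t)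

/-! ### Units -/

lemma smoothTransition_clamp (t : ℝ) : smoothTransition (clamp t) = smoothTransition t := by
  unfold clamp
  rcases le_total t 0 with h | h
  · rw [max_eq_left ((min_le_right _ _).trans h), Real.smoothTransition.zero_of_nonpos h,
      Real.smoothTransition.zero]
  rcases le_total t 1 with h' | h'
  · rw [min_eq_right h', max_eq_right h]
  · rw [min_eq_left h', max_eq_right zero_le_one, Real.smoothTransition.one_of_one_le h',
      Real.smoothTransition.one]

/-- Reparametrisation of paths by a smooth map `ℝ → ℝ` which maps `(-∞, 0]` and `[1, ∞)` to
themselves is homotopic to the identity. -/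
lemma homotopicOver_id_of_reparam {θ : ℝ → ℝ} (hθ : ContDiff ℝ ∞ θ) (h₀ : ∀ t ≤ 0, θ t ≤ 0)
    (h₁ : ∀ t, 1 ≤ t → 1 ≤ θ t) {f : PathSpace X → PathSpace X}
    (hf : ∀ g t, (f g).1.toFun t = g.1.toFun (θ t)) :
    HomotopicOver (pathPrecategory X) f id := by
  -- The linear homotopy from `θ` to the identity preserves both half-lines by convexity;
  -- `smoothTransition` makes its parameter smooth and insensitive to clamping.
  set Θ : ℝ × ℝ → ℝ := fun z ↦
    (1 - smoothTransition z.1) * θ z.2 + smoothTransition z.1 * z.2 with hΘ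
  have hs : ContDiff ℝ ∞ fun z : ℝ × ℝ ↦ smoothTransition z.1 :=
    (Real.smoothTransition.contDiff (n := ⊤)).comp contDiff_fst
  have hc : ContDiff ℝ ∞ Θ :=
    ((contDiff_const.sub hs).mul (hθ.comp contDiff_snd)).add (hs.mul contDiff_snd)
  have hΘ₀ (c t : ℝ) (ht : t ≤ 0) : Θ (c, t) ≤ 0 :=
    (convex_Iic (0 : ℝ)) (h₀ t ht) ht (sub_nonneg.2 (Real.smoothTransition.le_one c))
      (Real.smoothTransition.nonneg c) (by ring)
  have hΘ₁ (c t : ℝ) (ht : 1 ≤ t) : 1 ≤ Θ (c, t) :=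
    (convex_Ici (1 : ℝ)) (h₁ t ht) ht (sub_nonneg.2 (Real.smoothTransition.le_one c))
      (Real.smoothTransition.nonneg c) (by ring)
  refine ⟨fun z ↦ ⟨⟨fun t ↦ z.1.1.toFun (Θ (z.2, t)), ?_⟩, fun t ↦ ?_⟩, ?_, fun g c ↦ ?_,
    fun g ↦ ?_, fun g ↦ ?_, fun g c ↦ ⟨?_, ?_⟩⟩
  · exact z.1.1.smooth.comp (hc.comp (contDiff_const.prodMk contDiff_id)).dSmooth
  · change z.1.1.toFun _ = z.1.1.toFun _
    rcases le_total t 0 with h | h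
    · rw [clamp, max_eq_left ((min_le_right _ _).trans h),
        z.1.apply_of_nonpos (hΘ₀ _ _ le_rfl), z.1.apply_of_nonpos (hΘ₀ _ _ h)]
    rcases le_total t 1 with h' | h'
    · rw [clamp, min_eq_right h', max_eq_right h]
    · rw [clamp, min_eq_left h', max_eq_right zero_le_one,
        z.1.apply_of_one_le (hΘ₁ _ _ le_rfl), z.1.apply_of_one_le (hΘ₁ _ _ h')]
  · intro m p hp l q hq
    have hp₁ : DSmooth fun z : EuclideanSpace ℝ (Fin m) × ℝ ↦ ((p z.1).1).1.toFun z.2 := hp.1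
    have hp₂ : ContDiff ℝ ∞ fun a ↦ (p a).2 := isPlot_iff_contDiff.1 hp.2
    have hq₁ : ContDiff ℝ ∞ fun a ↦ (q a).1 := isPlot_iff_contDiff.1 hq.1
    have hq₂ : ContDiff ℝ ∞ fun a ↦ (q a).2 := isPlot_iff_contDiff.1 hq.2
    exact hp₁ l (fun a ↦ ((q a).1, Θ ((p (q a).1).2, (q a).2)))
      ⟨hq.1, (hc.comp ((hp₂.comp hq₁).prodMk hq₂)).isPlot⟩
  · refine Subtype.ext (SmoothMap.ext (funext fun t ↦ ?_))
    simp only [hΘ, smoothTransition_clamp]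
  · refine Subtype.ext (SmoothMap.ext (funext fun t ↦ ?_))
    simp [hΘ, hf]
  · refine Subtype.ext (SmoothMap.ext (funext fun t ↦ ?_))
    simp [hΘ]
  · exact g.apply_of_nonpos (hΘ₀ c 0 le_rfl)
  · exact g.apply_of_one_le (hΘ₁ c 1 le_rfl)

lemma contDiff_apexReparam (n : ℕ) : ContDiff ℝ ∞ (apexReparam n) :=
  (contDiff_stair n).comp (contDiff_const.mul (Real.smoothTransition.contDiff (n := ⊤)))

/-- On the first slot the argument `v - 1` is nonpositive, where `g` already rests at its source;
the constant path is thus absorbed into `g`. -/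
lemma total_unit_left (g : PathSpace X) (h) {v : ℝ} (hv : v ∈ Set.Icc (0 : ℝ) (2 : ℕ)) :
    total two_pos (Chain.pair (C := pathPrecategory X)
      ((pathPrecategory X).unit ((pathPrecategory X).src g)) g h) v = g.1.toFun (v - 1) := by
  obtain ⟨i, hi, hiv⟩ := exists_slot two_pos hv
  rw [total_eq _ _ hi hiv]
  interval_cases i
  · have := hiv.2
    push_cast at this
    exact (g.apply_of_nonpos (by linarith)).symm
  · simp [Chain.pair]

lemma total_unit_right (g : PathSpace X) (h) {v : ℝ} (hv : v ∈ Set.Icc (0 : ℝ) (2 : ℕ)) :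
    total two_pos (Chain.pair (C := pathPrecategory X) g
      ((pathPrecategory X).unit ((pathPrecategory X).tgt g)) h) v = g.1.toFun v := by
  obtain ⟨i, hi, hiv⟩ := exists_slot two_pos hv
  rw [total_eq _ _ hi hiv]
  interval_cases i
  · simp [Chain.pair]
  · have := hiv.1
    push_cast at this
    exact (g.apply_of_one_le this).symm

end Paths

end SmoothAInfty

open SmoothAInfty in
theorem mainTheorem2 (X : Type*) [DiffeologicalSpace X] :
    SmoothAInfty.IsHUnitalAInftyCategory (SmoothAInfty.pathPrecategory X) := by
  have hr := IsReparam.apex 2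
  -- With the unit on the left, `g` occupies the second slot, hence the shift by `1`; with the unit
  -- on the right there is no shift.
  refine ⟨pathForm X, homotopicOver_id_of_reparam (θ := fun t ↦ apexReparam 2 t - 1)
    ((contDiff_apexReparam 2).sub contDiff_const) (fun t ht ↦ ?_) (fun t ht ↦ ?_)
    (fun g t ↦ ?_), homotopicOver_id_of_reparam (θ := apexReparam 2)
    (contDiff_apexReparam 2) (fun t ht ↦ ?_) (fun t ht ↦ ?_) (fun g t ↦ ?_)⟩
  · rw [hr.of_nonpos t ht]; norm_num
  · rw [hr.of_one_le t ht]; norm_num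
  · exact (congrArg _ (congrFun (Associahedron.reparam_apex le_rfl) t)).trans
      (total_unit_left g rfl (hr.mem_Icc t))
  · rw [hr.of_nonpos t ht]
  · rw [hr.of_one_le t ht]; norm_num
  · exact (congrArg _ (congrFun (Associahedron.reparam_apex le_rfl) t)).trans
      (total_unit_right g rfl (hr.mem_Icc t))
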